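/- Let $m\ge 1$, let $\mathbb B\subset\mathbb R^{2m}$ be the open unit ball centred at the origin, with coordinates $(x_1,y_1,\dots,x_m,y_m)$, and let $\omega=\sum_{i=1}^m dx_i\wedge dy_i$ be the standard symplectic form. A contact form on a $(2m+1)$-dimensional manifold is a smooth $1$-form $\beta$ such that $\beta\wedge(d\beta)^m$ vanishes nowhere; its Reeb vector field $R_\beta$ is defined by $\iota_{R_\beta}d\beta=0$ and $\beta(R_\beta)=1$, and its volume is $\mathrm{vol}(\beta)=\int\beta\wedge(d\beta)^m$, in the orientation induced by $\beta$. Let $r,\epsilon>0$ be given and let $\lambda'$ be any smooth primitive of $\omega$ (that is, a smooth $1$-form with $d\lambda'=\omega$) on the open ball $r\mathbb B$ of radius $r$. Let $s$ denote the coordinate on $\mathbb R/\mathbb Z$. Then there exists a smooth contact form $\beta'$ on $r\mathbb B\times\mathbb R/\mathbb Z$ such that: 1. $\beta'=\lambda'+ds$ in a neighbourhood of the boundary $\partial(r\mathbb B\times\mathbb R/\mathbb Z)$, the boundary being taken in $\mathbb R^{2m}\times\mathbb R/\mathbb Z$; 2. $\beta'$ is smoothly isotopic to $\lambda'+ds$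 through contact forms rel boundary: there is a smooth path $(\beta_t)_{t\in[0,1]}$ of contact forms on $r\mathbb B\times\mathbb R/\mathbb Z$ with $\beta_0=\beta'$ and $\beta_1=\lambda'+ds$, such that all $\beta_t$ agree with $\lambda'+ds$ in one fixed neighbourhood of $\partial(r\mathbb B\times\mathbb R/\mathbb Z)$; 3. all closed orbits of $R_{\beta'}$ have period at least $1$; 4. $\mathrm{vol}(r\mathbb B\times\mathbb R/\mathbb Z,\beta')<\epsilon$. -/

import Mathlib

open Set Filter Topology MeasureTheory
open scoped ContDiff ENNReal

namespace ContactPlug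

noncomputable section

/-- `ℝ²ᵐ = ℂᵐ` with its Euclidean norm; the coordinates of `z` are
`x_i = z (i, 0)` and `y_i = z (i, 1)` for `i : Fin m`. -/
abbrev Eucl (m : ℕ) : Type := EuclideanSpace ℝ (Fin m × Fin 2)

/-- The exterior derivative of a 1-form on a normed space (a 1-form being given by a continuous
linear functional at each point), through Mathlib's `extDeriv`. -/
def dOne {V : Type*} [NormedAddCommGroup V] [NormedSpace ℝ V]
    (a : V → (V →L[ℝ] ℝ)) (p : V) : V [⋀^Fin 2]→L[ℝ] ℝ :=
  extDeriv (fun q => ContinuousAlternatingMap.ofSubsingleton ℝ V ℝ (0 : Fin 1) (a q)) p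

/-- `da (u, v) = D_u a (v) - D_v a (u)`. -/
theorem dOne_apply {V : Type*} [NormedAddCommGroup V] [NormedSpace ℝ V]
    {a : V → (V →L[ℝ] ℝ)} {p : V} (ha : DifferentiableAt ℝ a p) (u v : V) :
    dOne a p ![u, v] = fderiv ℝ a p u v - fderiv ℝ a p v u := by
  have hL : DifferentiableAt ℝ
      (fun q => ContinuousAlternatingMap.ofSubsingleton ℝ V ℝ (0 : Fin 1) (a q)) p :=
    (ContinuousAlternatingMap.ofSubsingletonLIE (𝕜 := ℝ) (E := V) (F := ℝ)
      (0 : Fin 1)).differentiableAt.comp p ha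
  have key : ∀ w z : V, fderiv ℝ (fun q => a q w) p z = fderiv ℝ a p z w := by
    intro w z
    rw [fderiv_clm_apply ha (differentiableAt_const w)]
    simp
  rw [dOne, extDeriv_apply hL]
  simp [Fin.sum_univ_two, Fin.removeNth, key, sub_eq_add_neg]

/-- The standard symplectic form `ω = ∑ i, dx_i ∧ dy_i` (it has constant coefficients). -/
def stdSymplectic (m : ℕ) (u v : Eucl m) : ℝ :=
  ∑ i : Fin m, (u (i, 0) * v (i, 1) - u (i, 1) * v (i, 0))

/-- `lam` is a primitive of `ω` on the open ball `rB`: a smooth 1-form there with `d lam = ω`. -/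
def IsPrimitive (m : ℕ) (r : ℝ) (lam : Eucl m → (Eucl m →L[ℝ] ℝ)) : Prop :=
  ContDiffOn ℝ ∞ lam (Metric.ball 0 r) ∧
    ∀ z ∈ Metric.ball (0 : Eucl m) r, ∀ u v : Eucl m,
      dOne lam z ![u, v] = stdSymplectic m u v

/-- The manifold `rB × ℝ/ℤ`, as a subset of `ℝ²ᵐ × ℝ/ℤ`. -/
def solidTorus (m : ℕ) (r : ℝ) : Set (Eucl m × UnitAddCircle) :=
  Metric.ball 0 r ×ˢ univ

/-- Its universal cover `rB × ℝ`. -/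
def coverTorus (m : ℕ) (r : ℝ) : Set (Eucl m × ℝ) :=
  Metric.ball 0 r ×ˢ univ

/-- The covering map `ℝ²ᵐ × ℝ → ℝ²ᵐ × ℝ/ℤ`. -/
def toTorus {m : ℕ} (p : Eucl m × ℝ) : Eucl m × UnitAddCircle :=
  (p.1, (p.2 : UnitAddCircle))

/-- 1-forms on `ℝ²ᵐ × ℝ/ℤ`; every tangent space is `ℝ²ᵐ × ℝ` (with `∂_s = (0, 1)`), as
`toTorus` is a local diffeomorphism. Only the values on `solidTorus m r` matter below. -/
abbrev OneForm (m : ℕ) : Type := Eucl m × UnitAddCircle → (Eucl m × ℝ →L[ℝ] ℝ)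

/-- The pull-back of a 1-form to the universal cover. -/
def OneForm.lift {m : ℕ} (b : OneForm m) (p : Eucl m × ℝ) : Eucl m × ℝ →L[ℝ] ℝ :=
  b (toTorus p)

/-- The 1-form `lam + ds`. -/
def addDs {m : ℕ} (lam : Eucl m → (Eucl m →L[ℝ] ℝ)) : OneForm m :=
  fun p => (lam p.1).comp (ContinuousLinearMap.fst ℝ (Eucl m) ℝ) +
    ContinuousLinearMap.snd ℝ (Eucl m) ℝ

/-- The oriented frame `∂_s, ∂_{x_1}, ∂_{y_1}, …, ∂_{x_m}, ∂_{y_m}` of `ℝ²ᵐ × ℝ`, where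
`none` labels `∂_s`, `some (i, 0)` labels `∂_{x_i}` and `some (i, 1)` labels `∂_{y_i}`. -/
def frame (m : ℕ) : Option (Fin m × Fin 2) → Eucl m × ℝ
  | none => (0, 1)
  | some k => (EuclideanSpace.single k 1, 0)

/-- The coefficient of `a ∧ (da)ᵐ` with respect to the coordinate volume
`ds ∧ dx_1 ∧ dy_1 ∧ ⋯ ∧ dx_m ∧ dy_m`, that is, the value of `a ∧ (da)ᵐ` on `frame m`:
`(1/2ᵐ) ∑_σ sign σ · a(e_σ(none)) ∏_i da(e_σ(i,0), e_σ(i,1))`. -/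
def contactDensity {m : ℕ} (a : Eucl m × ℝ → (Eucl m × ℝ →L[ℝ] ℝ)) (p : Eucl m × ℝ) : ℝ :=
  (1 / 2 ^ m : ℝ) * ∑ σ : Equiv.Perm (Option (Fin m × Fin 2)),
    ((Equiv.Perm.sign σ : ℤ) : ℝ) * a p (frame m (σ none)) *
      ∏ i : Fin m, dOne a p ![frame m (σ (some (i, 0))), frame m (σ (some (i, 1)))]

/-- `b` is smooth on `rB × ℝ/ℤ` and `b ∧ (db)ᵐ` vanishes nowhere there. -/
def IsContactForm (m : ℕ) (r : ℝ) (b : OneForm m) : Prop :=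
  ContDiffOn ℝ ∞ b.lift (coverTorus m r) ∧ ∀ p ∈ coverTorus m r, contactDensity b.lift p ≠ 0

/-- The volume of `rB × ℝ/ℤ` with respect to `b ∧ (db)ᵐ`, in the orientation that a contact form
`b` induces, computed on the fundamental domain `rB × [0, 1)`. -/
def contactVolume (m : ℕ) (r : ℝ) (b : OneForm m) : ℝ≥0∞ :=
  ∫⁻ p in (Metric.ball (0 : Eucl m) r ×ˢ Ico (0 : ℝ) 1), ENNReal.ofReal |contactDensity b.lift p|

/-- `v` is the value at (the image of) `p` of the Reeb vector field of `b`. -/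
def IsReebVector {m : ℕ} (b : OneForm m) (p v : Eucl m × ℝ) : Prop :=
  b.lift p v = 1 ∧ ∀ u : Eucl m × ℝ, dOne b.lift p ![v, u] = 0

/-- `T > 0` is a period of the closed Reeb orbit `toTorus ∘ γ` of `b` in `rB × ℝ/ℤ`, where `γ` is
a lift of the orbit to the universal cover. -/
def IsClosedReebOrbit (m : ℕ) (r : ℝ) (b : OneForm m) (γ : ℝ → Eucl m × ℝ) (T : ℝ) : Prop :=
  0 < T ∧ (∀ t, γ t ∈ coverTorus m r) ∧
    (∀ t, ∃ v, IsReebVector b (γ t) v ∧ HasDerivAt γ v t) ∧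
    Function.Periodic (fun t => toTorus (γ t)) T

/-- `b₀` and `b₁` are joined by a smooth path of contact forms on `rB × ℝ/ℤ` that all agree with
`c` in a fixed neighbourhood of the boundary of `rB × ℝ/ℤ`. -/
def IsotopicRelBoundary (m : ℕ) (r : ℝ) (b₀ b₁ c : OneForm m) : Prop :=
  ∃ b : ℝ → OneForm m,
    ContDiffOn ℝ ∞ (fun q : ℝ × (Eucl m × ℝ) => (b q.1).lift q.2)
      (Icc 0 1 ×ˢ coverTorus m r) ∧
    (∀ t ∈ Icc (0 : ℝ) 1, IsContactForm m r (b t)) ∧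
    EqOn (b 0) b₀ (solidTorus m r) ∧ EqOn (b 1) b₁ (solidTorus m r) ∧
    ∃ U ∈ 𝓝ˢ (frontier (solidTorus m r)),
      ∀ t ∈ Icc (0 : ℝ) 1, EqOn (b t) c (U ∩ solidTorus m r)

end

end ContactPlug

/-! Write `λ₀` for the radial primitive `liouville`. On the ball `lam - λ₀` is closed, hence equal
to `df`, so with `h = s + f(z)` the form `lam + ds` becomes `λ₀ + dh`.

Let `τ = 2π/n`. A term `outer(|z|²) dh` is added that vanishes near the boundary and is affine of
slope `-τ/2` in `|z|²` on a slightly smaller ball. In the rotating frame `w = rot(-τh) z` one has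
`λ₀(z) = λ₀(w) + (τ/2)|w|² dh`, so on that ball the new form is `λ₀(w) + b dh` with a constant `b ≥
1`. Its Reeb flow fixes `w`, and its first return map is the rotation by `2π/n`.

Almost all of the ball is filled by finitely many disjoint closed balls that this rotation permutes
freely (`exists_packing`). The tube over such a ball closes up only after `n` turns, so its orbits
are about `n` times longer than required, and this surplus is traded for volume. With `u = w - c`
and `φ = b h + λ₀(c)(w)` the form in the tube is `λ₀(u) + dφ`; it is replaced by `λ₀(u) + (1 -
g(|u|²)) dφ` for a bump `g`. The density is multiplied by `1 - g + ρ g'` at `ρ = |u|²`, which is at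
least `1/n` everywhere and close to `1/n` on most of the tube. The Reeb flow preserves `|u|` and
moves `φ` with speed at most `n`, whereas `φ` grows by at least `n b` along a closed orbit. Outside
the tubes `h` has speed at most `1` and grows by a positive integer. Both cases give period at least
`1` (`Plug.one_le_period`).

The volume is controlled by about `1/n` of the volume of the ball plus the part not filled by the
balls (`Plug.contactVolume_le`). Switching off first the bumps and then the rotation term is an
isotopy through contact forms (`Plug.isotopic`). -/

namespace ContactPlug

noncomputable section

/-! ### Linear algebra of `α ∧ Ωᵐ` in dimension `2m + 1` -/

/-- The value of `α ∧ Ωᵐ` on the frame `v`. -/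
def topCoeff {V : Type*} [NormedAddCommGroup V] [NormedSpace ℝ V] (m : ℕ) (α : V →L[ℝ] ℝ)
    (Ω : V [⋀^Fin 2]→L[ℝ] ℝ) (v : Option (Fin m × Fin 2) → V) : ℝ :=
  (1 / 2 ^ m : ℝ) * ∑ σ : Equiv.Perm (Option (Fin m × Fin 2)),
    ((Equiv.Perm.sign σ : ℤ) : ℝ) * α (v (σ none)) *
      ∏ i : Fin m, Ω ![v (σ (some (i, 0))), v (σ (some (i, 1)))]

theorem contactDensity_eq_topCoeff {m : ℕ} (a : Eucl m × ℝ → (Eucl m × ℝ →L[ℝ] ℝ))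
    (p : Eucl m × ℝ) : contactDensity a p = topCoeff m (a p) (dOne a p) (frame m) := rfl

section Alternating

variable {V : Type*} [NormedAddCommGroup V] [NormedSpace ℝ V] {m : ℕ}

theorem two_add_left (Ω : V [⋀^Fin 2]→L[ℝ] ℝ) (x y z : V) :
    Ω ![x + y, z] = Ω ![x, z] + Ω ![y, z] := by
  simpa using (Ω.map_vecCons_add ![z] x y)

theorem two_smul_left (Ω : V [⋀^Fin 2]→L[ℝ] ℝ) (c : ℝ) (x z : V) :
    Ω ![c • x, z] = c * Ω ![x, z] := by
  simpa using (Ω.map_vecCons_smul ![z] c x)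

theorem two_swap (Ω : V [⋀^Fin 2]→L[ℝ] ℝ) (x z : V) : Ω ![x, z] = - Ω ![z, x] := by
  have := Ω.toAlternatingMap.map_swap ![z, x] (i := 0) (j := 1) (by decide)
  rw [ContinuousAlternatingMap.coe_toAlternatingMap] at this
  rw [← this]
  congr 1
  ext i
  fin_cases i <;> simp

theorem two_add_right (Ω : V [⋀^Fin 2]→L[ℝ] ℝ) (x y z : V) :
    Ω ![z, x + y] = Ω ![z, x] + Ω ![z, y] := by
  rw [two_swap, two_add_left, two_swap Ω z x, two_swap Ω z y]; ring

theorem two_smul_right (Ω : V [⋀^Fin 2]→L[ℝ] ℝ) (c : ℝ) (x z : V) :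
    Ω ![z, c • x] = c * Ω ![z, x] := by
  rw [two_swap, two_smul_left, two_swap Ω z x]; ring

theorem prod_two_update (Ω : V [⋀^Fin 2]→L[ℝ] ℝ) [DecidableEq (Option (Fin m × Fin 2))]
    (v : Option (Fin m × Fin 2) → V) (j : Fin m) (e : Fin 2) (x : V) :
    ∏ i : Fin m, Ω ![Function.update v (some (j, e)) x (some (i, 0)),
      Function.update v (some (j, e)) x (some (i, 1))] =
    Ω ![if e = 0 then x else v (some (j, 0)), if e = 1 then x else v (some (j, 1))] *
      ∏ i ∈ Finset.univ.erase j, Ω ![v (some (i, 0)), v (some (i, 1))] := by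
  rw [← Finset.mul_prod_erase _ _ (Finset.mem_univ j)]
  congr 1
  · fin_cases e <;> simp
  · refine Finset.prod_congr rfl fun i hi => ?_
    have hij : i ≠ j := Finset.ne_of_mem_erase hi
    simp [hij]

/-- `v ↦ α (v none) * ∏ i, Ω (v (i, 0), v (i, 1))`. -/
def productForm (m : ℕ) (α : V →L[ℝ] ℝ) (Ω : V [⋀^Fin 2]→L[ℝ] ℝ) :
    MultilinearMap ℝ (fun _ : Option (Fin m × Fin 2) => V) ℝ where
  toFun v := α (v none) * ∏ i : Fin m, Ω ![v (some (i, 0)), v (some (i, 1))]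
  map_update_add' := by
    intro _ v k x y
    rcases k with _ | ⟨j, e⟩
    · simp; ring
    · simp only [prod_two_update]
      fin_cases e <;> simp [two_add_left, two_add_right] <;> ring
  map_update_smul' := by
    intro _ v k c x
    rcases k with _ | ⟨j, e⟩
    · simp; ring
    · simp only [prod_two_update]
      fin_cases e <;> simp [two_smul_left, two_smul_right] <;> ring

theorem topCoeff_eq_alternatization (α : V →L[ℝ] ℝ) (Ω : V [⋀^Fin 2]→L[ℝ] ℝ)
    (v : Option (Fin m × Fin 2) → V) :
    topCoeff m α Ω v = (1 / 2 ^ m : ℝ) * MultilinearMap.alternatization (productForm m α Ω) v := by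
  rw [topCoeff, MultilinearMap.alternatization_apply]
  congr 1
  refine Finset.sum_congr rfl fun σ _ => ?_
  simp [productForm, MultilinearMap.domDomCongr_apply, Units.smul_def, mul_assoc]

end Alternating

/-- `frame m` as a basis. -/
def frameBasis (m : ℕ) : Module.Basis (Option (Fin m × Fin 2)) ℝ (Eucl m × ℝ) :=
  ((EuclideanSpace.basisFun (Fin m × Fin 2) ℝ).toBasis.prod
    (Module.Basis.singleton PUnit.{1} ℝ)).reindex (Equiv.optionEquivSumPUnit _).symm

theorem coe_frameBasis (m : ℕ) : ⇑(frameBasis m) = frame m := by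
  ext k
  · rcases k with _ | k <;> simp [frameBasis, frame]
  · rcases k with _ | k <;> simp [frameBasis, frame]

/-- An alternating map in as many arguments as the dimension is a multiple of the determinant in the
basis `frameBasis m`. -/
theorem topCoeff_comp_frame {m : ℕ} (α : Eucl m × ℝ →L[ℝ] ℝ)
    (Ω : (Eucl m × ℝ) [⋀^Fin 2]→L[ℝ] ℝ) (L : Eucl m × ℝ →ₗ[ℝ] Eucl m × ℝ) :
    topCoeff m α Ω (L ∘ frame m) = LinearMap.det L * topCoeff m α Ω (frame m) := by
  simp only [topCoeff_eq_alternatization, ← coe_frameBasis]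
  rw [AlternatingMap.eq_smul_basis_det (frameBasis m)
    (MultilinearMap.alternatization (productForm m α Ω))]
  simp [Module.Basis.det_comp]
  ring

/-- Pulling back by a linear map multiplies the coefficient of `α ∧ Ωᵐ` by the determinant. -/
theorem topCoeff_pullback {m : ℕ} (α : Eucl m × ℝ →L[ℝ] ℝ)
    (Ω : (Eucl m × ℝ) [⋀^Fin 2]→L[ℝ] ℝ) (L : Eucl m × ℝ →L[ℝ] Eucl m × ℝ) :
    topCoeff m (α.comp L) (Ω.compContinuousLinearMap L) (frame m) =
      LinearMap.det (L : Eucl m × ℝ →ₗ[ℝ] Eucl m × ℝ) * topCoeff m α Ω (frame m) := by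
  rw [← topCoeff_comp_frame]
  simp only [topCoeff]
  congr 1
  refine Finset.sum_congr rfl fun σ _ => ?_
  congr 1
  refine Finset.prod_congr rfl fun i _ => ?_
  rw [ContinuousAlternatingMap.compContinuousLinearMap_apply]
  congr 1
  ext k <;> fin_cases k <;> rfl

/-! ### Reduction to the standard volume form and its positivity -/

/-- The coefficient of `ds ∧ ωᵐ`. -/
def stdCoeff (m : ℕ) : ℝ :=
  (1 / 2 ^ m : ℝ) * ∑ σ : Equiv.Perm (Option (Fin m × Fin 2)),
    ((Equiv.Perm.sign σ : ℤ) : ℝ) * (if σ none = none then 1 else 0) *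
      ∏ i : Fin m, stdSymplectic m (frame m (σ (some (i, 0)))).1 (frame m (σ (some (i, 1)))).1

/-- A transvection, of determinant `1`, replaces `∂_s` in the frame by the vector `(Y, 1)` of the
kernel of `Ω`. Every permutation that puts this vector into a factor `Ω` contributes `0`; the others
put it into `α`. -/
theorem topCoeff_eq_of_kernel {m : ℕ} (α : Eucl m × ℝ →L[ℝ] ℝ)
    (Ω : (Eucl m × ℝ) [⋀^Fin 2]→L[ℝ] ℝ) (Y : Eucl m)
    (hY : ∀ u, Ω ![(Y, 1), u] = 0)
    (hΩ : ∀ u v : Eucl m, Ω ![(u, 0), (v, 0)] = stdSymplectic m u v) :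
    topCoeff m α Ω (frame m) = α (Y, 1) * stdCoeff m := by
  have hdet := topCoeff_comp_frame α Ω
    (LinearMap.transvection (LinearMap.snd ℝ (Eucl m) ℝ) ((Y, 0) : Eucl m × ℝ))
  rw [LinearMap.transvection.det (LinearMap.snd ℝ (Eucl m) ℝ : Eucl m × ℝ →ₗ[ℝ] ℝ)
    ((Y, 0) : Eucl m × ℝ), LinearMap.snd_apply, add_zero, one_mul] at hdet
  rw [← hdet, topCoeff, stdCoeff, mul_left_comm (α (Y, 1))]
  congr 1
  rw [Finset.mul_sum]
  have hnone : LinearMap.transvection (LinearMap.snd ℝ (Eucl m) ℝ) ((Y, 0) : Eucl m × ℝ)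
      (frame m none) = (Y, 1) := by
    rw [LinearMap.transvection.apply]; simp [frame]
  have hsome : ∀ k, LinearMap.transvection (LinearMap.snd ℝ (Eucl m) ℝ) ((Y, 0) : Eucl m × ℝ)
      (frame m (some k)) = ((frame m (some k)).1, 0) := by
    intro k
    rw [LinearMap.transvection.apply]; simp [frame]
  refine Finset.sum_congr rfl fun σ _ => ?_
  simp only [Function.comp_apply]
  by_cases hσ : σ none = none
  · rw [hσ, hnone]
    have : ∀ k, ∃ l, σ (some k) = some l := by
      intro k
      refine Option.ne_none_iff_exists'.1 fun h => ?_
      have := σ.injective (h.trans hσ.symm)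
      simp at this
    have hprod : ∀ i : Fin m, Ω ![LinearMap.transvection (LinearMap.snd ℝ (Eucl m) ℝ)
          ((Y, 0) : Eucl m × ℝ) (frame m (σ (some (i, 0)))),
          LinearMap.transvection (LinearMap.snd ℝ (Eucl m) ℝ)
          ((Y, 0) : Eucl m × ℝ) (frame m (σ (some (i, 1))))] =
        stdSymplectic m (frame m (σ (some (i, 0)))).1 (frame m (σ (some (i, 1)))).1 := by
      intro i
      obtain ⟨l, hl⟩ := this (i, 0)
      obtain ⟨l', hl'⟩ := this (i, 1)
      rw [hl, hl', hsome, hsome, hΩ]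
    rw [Finset.prod_congr rfl fun i _ => hprod i]
    simp only [if_true]
    ring
  · rw [if_neg hσ]
    have : ∏ i : Fin m, Ω ![LinearMap.transvection (LinearMap.snd ℝ (Eucl m) ℝ)
          ((Y, 0) : Eucl m × ℝ) (frame m (σ (some (i, 0)))),
          LinearMap.transvection (LinearMap.snd ℝ (Eucl m) ℝ)
          ((Y, 0) : Eucl m × ℝ) (frame m (σ (some (i, 1))))] = 0 := by
      obtain ⟨k, hk⟩ := σ.surjective none
      rcases k with _ | ⟨i, e⟩
      · exact absurd hk hσ
      · refine Finset.prod_eq_zero (Finset.mem_univ i) ?_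
        fin_cases e
        · simp only [Fin.zero_eta] at hk
          rw [hk, hnone, hY]
        · simp only [Fin.mk_one] at hk
          rw [hk, hnone, two_swap, hY, neg_zero]
    rw [this]
    ring

theorem stdSymplectic_single {m : ℕ} (k l : Fin m × Fin 2) :
    stdSymplectic m (EuclideanSpace.single k 1) (EuclideanSpace.single l 1) =
      if k.1 = l.1 then (if k.2 = 0 ∧ l.2 = 1 then 1 else if k.2 = 1 ∧ l.2 = 0 then -1 else 0)
        else 0 := by
  obtain ⟨i, e⟩ := k
  obtain ⟨j, d⟩ := l
  simp only [stdSymplectic]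
  rw [Finset.sum_eq_single i]
  · fin_cases e <;> fin_cases d <;> simp [eq_comm]
    split_ifs <;> simp
  · intro b _ hb
    simp [hb]
  · simp

theorem perm_fin_two_sign (ε : Equiv.Perm (Fin 2)) :
    (if ε 0 = 0 ∧ ε 1 = 1 then (1 : ℤ) else if ε 0 = 1 ∧ ε 1 = 0 then -1 else 0) =
      Equiv.Perm.sign ε := by
  revert ε
  decide

/-- If the product is not zero, `π` permutes the `m` coordinate planes by some `ρ` and acts inside
the `i`-th one by some `ε i`. As `ρ` acts once on each of the two coordinates, its sign cancels, so
both the sign of `π` and the product equal `∏ sign (ε i)`, and the term is a square. -/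
theorem sign_mul_prod_stdSymplectic_nonneg {m : ℕ} (π : Equiv.Perm (Fin m × Fin 2)) :
    0 ≤ ((Equiv.Perm.sign π : ℤ) : ℝ) * ∏ i : Fin m,
      stdSymplectic m (EuclideanSpace.single (π (i, 0)) 1)
        (EuclideanSpace.single (π (i, 1)) 1) := by
  simp only [stdSymplectic_single]
  by_cases h : ∀ i, (π (i, 0)).1 = (π (i, 1)).1
  · have hfst : ∀ i e, (π (i, e)).1 = (π (i, 0)).1 := by
      intro i e
      fin_cases e
      · rfl
      · exact (h i).symm
    have hε : ∀ i, Function.Injective fun e => (π (i, e)).2 := by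
      intro i e d hed
      have : π (i, e) = π (i, d) := Prod.ext ((hfst i e).trans (hfst i d).symm) hed
      simpa using π.injective this
    have hρ : Function.Injective fun i => (π (i, 0)).1 := by
      intro i j hij
      obtain ⟨e, he⟩ := (Finite.injective_iff_surjective.1 (hε i)) (π (j, 0)).2
      have : π (i, e) = π (j, 0) := Prod.ext ((hfst i e).trans hij) he
      exact (Prod.ext_iff.1 (π.injective this)).1
    let ρ : Equiv.Perm (Fin m) := Equiv.ofBijective _ (Finite.injective_iff_bijective.1 hρ)
    let ε : Fin m → Equiv.Perm (Fin 2) := fun i =>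
      Equiv.ofBijective _ (Finite.injective_iff_bijective.1 (hε i))
    have hπ : π = (Equiv.prodCongrLeft fun _ : Fin 2 => ρ) * Equiv.prodCongrRight ε := by
      ext ⟨i, e⟩ : 1
      exact Prod.ext (hfst i e) rfl
    have hsign : Equiv.Perm.sign π = ∏ i, Equiv.Perm.sign (ε i) := by
      rw [hπ, Equiv.Perm.sign_mul, Equiv.Perm.sign_prodCongrLeft, Equiv.Perm.sign_prodCongrRight]
      simp
    have hterm : ∀ i, (if (π (i, 0)).1 = (π (i, 1)).1 then
        (if (π (i, 0)).2 = 0 ∧ (π (i, 1)).2 = 1 then (1 : ℝ)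
          else if (π (i, 0)).2 = 1 ∧ (π (i, 1)).2 = 0 then -1 else 0) else 0) =
        ((Equiv.Perm.sign (ε i) : ℤ) : ℝ) := by
      intro i
      rw [if_pos (h i), ← perm_fin_two_sign]
      push_cast
      rfl
    rw [Finset.prod_congr rfl fun i _ => hterm i, hsign]
    push_cast
    exact mul_self_nonneg _
  · push Not at h
    obtain ⟨i, hi⟩ := h
    rw [Finset.prod_eq_zero (Finset.mem_univ i) (if_neg hi), mul_zero]

/-- No permutation contributes negatively and the identity contributes `1`. The exact value `m!`
plays no role. -/
theorem stdCoeff_pos (m : ℕ) : 0 < stdCoeff m := by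
  refine mul_pos (by positivity) (Finset.sum_pos' (fun σ _ => ?_) ⟨1, Finset.mem_univ _, ?_⟩)
  · by_cases hσ : σ none = none
    · have hs : ∀ k, σ (some k) = some (Equiv.removeNone σ k) := by
        intro k
        refine (Equiv.removeNone_some σ ?_).symm
        refine Option.ne_none_iff_exists'.1 fun h => ?_
        simpa using σ.injective (h.trans hσ.symm)
      have hσ' : σ = (Equiv.removeNone σ).optionCongr := by
        ext1 k
        rcases k with _ | k
        · simpa using hσ
        · rw [hs k, Equiv.optionCongr_apply, Option.map_some]
      have hsign : Equiv.Perm.sign σ = Equiv.Perm.sign (Equiv.removeNone σ) := by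
        conv_lhs => rw [hσ']
        exact Equiv.optionCongr_sign _
      rw [if_pos hσ, mul_one, hsign]
      simp only [hs, frame]
      exact sign_mul_prod_stdSymplectic_nonneg _
    · simp [hσ]
  · simp [frame, stdSymplectic_single]

/-! ### Locality and naturality of the exterior derivative -/

theorem dOne_congr {V : Type*} [NormedAddCommGroup V] [NormedSpace ℝ V]
    {a b : V → (V →L[ℝ] ℝ)} {p : V} (h : a =ᶠ[𝓝 p] b) : dOne a p = dOne b p := by
  unfold dOne
  refine Filter.EventuallyEq.extDeriv_eq ?_
  filter_upwards [h] with q hq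
  rw [hq]

theorem dOne_pullback {V : Type*} [NormedAddCommGroup V] [NormedSpace ℝ V]
    {a : V → (V →L[ℝ] ℝ)} {Ψ : V → V} {p : V} (ha : DifferentiableAt ℝ a (Ψ p))
    (hΨ : ContDiffAt ℝ ∞ Ψ p) :
    dOne (fun q => (a (Ψ q)).comp (fderiv ℝ Ψ q)) p =
      (dOne a (Ψ p)).compContinuousLinearMap (fderiv ℝ Ψ p) := by
  have hL : DifferentiableAt ℝ
      (fun q => ContinuousAlternatingMap.ofSubsingleton ℝ V ℝ (0 : Fin 1) (a q)) (Ψ p) :=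
    (ContinuousAlternatingMap.ofSubsingletonLIE (𝕜 := ℝ) (E := V) (F := ℝ)
      (0 : Fin 1)).differentiableAt.comp (Ψ p) ha
  unfold dOne
  rw [← extDeriv_pullback hL hΨ (r := ∞) ?_]
  · rfl
  · simp only [minSmoothness_of_isRCLikeNormedField]
    exact WithTop.coe_le_coe.2 le_top

/-! ### The complex structure and radial contact forms -/

variable {m : ℕ}

/-- The standard complex structure of `ℝ²ᵐ = ℂᵐ`. -/
def cplx (m : ℕ) : Eucl m →L[ℝ] Eucl m :=
  LinearMap.toContinuousLinearMap
    { toFun := fun z => WithLp.toLp 2 fun k => if k.2 = 0 then -z (k.1, 1) else z (k.1, 0)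
      map_add' := by
        intro x y
        ext ⟨i, e⟩
        fin_cases e <;> simp [add_comm]
      map_smul' := by
        intro c x
        ext ⟨i, e⟩
        fin_cases e <;> simp }

@[simp] theorem cplx_apply_zero (z : Eucl m) (i : Fin m) : cplx m z (i, 0) = -z (i, 1) := by
  simp [cplx]

@[simp] theorem cplx_apply_one (z : Eucl m) (i : Fin m) : cplx m z (i, 1) = z (i, 0) := by
  simp [cplx]

@[simp] theorem cplx_cplx (z : Eucl m) : cplx m (cplx m z) = -z := by
  ext ⟨i, e⟩
  fin_cases e <;> simp

theorem inner_cplx_left (u v : Eucl m) : inner ℝ (cplx m u) v = stdSymplectic m u v := by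
  rw [PiLp.inner_apply, Fintype.sum_prod_type, stdSymplectic]
  refine Finset.sum_congr rfl fun i _ => ?_
  simp [Fin.sum_univ_two]
  ring

theorem inner_cplx_comm (u v : Eucl m) : inner ℝ (cplx m u) v = -inner ℝ u (cplx m v) := by
  rw [real_inner_comm (cplx m v) u, inner_cplx_left, inner_cplx_left, stdSymplectic, stdSymplectic,
    ← Finset.sum_neg_distrib]
  refine Finset.sum_congr rfl fun i _ => ?_
  ring

@[simp] theorem inner_cplx_cplx (u v : Eucl m) :
    inner ℝ (cplx m u) (cplx m v) = inner ℝ u v := by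
  rw [inner_cplx_comm, cplx_cplx, inner_neg_right, neg_neg]

@[simp] theorem inner_self_cplx (u : Eucl m) : inner ℝ u (cplx m u) = 0 := by
  have h := inner_cplx_comm u u
  rw [real_inner_comm] at h
  linarith

@[simp] theorem inner_cplx_self (u : Eucl m) : inner ℝ (cplx m u) u = 0 := by
  rw [real_inner_comm, inner_self_cplx]

@[simp] theorem norm_cplx (u : Eucl m) : ‖cplx m u‖ = ‖u‖ := by
  rw [norm_eq_sqrt_real_inner, inner_cplx_cplx, ← norm_eq_sqrt_real_inner]

/-- The radial primitive `½ ∑ (x_i dy_i - y_i dx_i)` of the standard symplectic form. -/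
def liouville (m : ℕ) : Eucl m →L[ℝ] (Eucl m →L[ℝ] ℝ) :=
  (1 / 2 : ℝ) • (innerSL ℝ).comp (cplx m)

@[simp] theorem liouville_apply (z v : Eucl m) :
    liouville m z v = 1 / 2 * inner ℝ (cplx m z) v := by
  simp [liouville]

/-- The 1-form `λ₀ + (1 - h(|z|²)) ds`. -/
def radialForm (h : ℝ → ℝ) (p : Eucl m × ℝ) : Eucl m × ℝ →L[ℝ] ℝ :=
  (liouville m p.1).comp (ContinuousLinearMap.fst ℝ (Eucl m) ℝ) +
    (1 - h (‖p.1‖ ^ 2)) • ContinuousLinearMap.snd ℝ (Eucl m) ℝ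

theorem radialForm_apply (h : ℝ → ℝ) (p v : Eucl m × ℝ) :
    radialForm h p v = 1 / 2 * inner ℝ (cplx m p.1) v.1 + (1 - h (‖p.1‖ ^ 2)) * v.2 := by
  simp [radialForm]

theorem hasFDerivAt_radialForm {h : ℝ → ℝ} {h' : ℝ} (p : Eucl m × ℝ)
    (hh : HasDerivAt h h' (‖p.1‖ ^ 2)) :
    ∃ D : Eucl m × ℝ →L[ℝ] (Eucl m × ℝ →L[ℝ] ℝ), HasFDerivAt (radialForm h) D p ∧
      ∀ u v, D u v = 1 / 2 * inner ℝ (cplx m u.1) v.1 - h' * (2 * inner ℝ p.1 u.1) * v.2 := by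
  have h1 : HasFDerivAt (fun p : Eucl m × ℝ => (liouville m p.1).comp
      (ContinuousLinearMap.fst ℝ (Eucl m) ℝ)) _ p :=
    (((ContinuousLinearMap.compL ℝ (Eucl m × ℝ) (Eucl m) ℝ).flip
      (ContinuousLinearMap.fst ℝ (Eucl m) ℝ)).comp
      ((liouville m).comp (ContinuousLinearMap.fst ℝ (Eucl m) ℝ))).hasFDerivAt
  have h2 : HasFDerivAt (fun p : Eucl m × ℝ => ‖p.1‖ ^ 2) _ p :=
    (hasStrictFDerivAt_norm_sq p.1).hasFDerivAt.comp p hasFDerivAt_fst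
  have h3 := ((hh.comp_hasFDerivAt p h2).const_sub 1).smul_const
    (ContinuousLinearMap.snd ℝ (Eucl m) ℝ)
  refine ⟨_, h1.add h3, fun u v => ?_⟩
  simp
  ring

theorem dOne_radialForm {h : ℝ → ℝ} {h' : ℝ} (p : Eucl m × ℝ)
    (hh : HasDerivAt h h' (‖p.1‖ ^ 2)) (u v : Eucl m × ℝ) :
    dOne (radialForm h) p ![u, v] = inner ℝ (cplx m u.1) v.1 -
      2 * h' * (inner ℝ p.1 u.1 * v.2 - inner ℝ p.1 v.1 * u.2) := by
  obtain ⟨D, hD, hDuv⟩ := hasFDerivAt_radialForm p hh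
  rw [dOne_apply hD.differentiableAt, hD.fderiv, hDuv, hDuv, inner_cplx_comm v.1 u.1,
    real_inner_comm (cplx m u.1) v.1]
  ring

/-- The contact density of the radial form. -/
theorem topCoeff_radialForm {h : ℝ → ℝ} {h' : ℝ} (p : Eucl m × ℝ)
    (hh : HasDerivAt h h' (‖p.1‖ ^ 2)) :
    topCoeff m (radialForm h p) (dOne (radialForm h) p) (frame m) =
      (1 - h (‖p.1‖ ^ 2) + ‖p.1‖ ^ 2 * h') * stdCoeff m := by
  -- The kernel of the differential is spanned by `∂_s + 2h' J z`, where `J = cplx m`: the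
  -- Hamiltonian flow of a function of `|z|²` rotates the spheres.
  rw [topCoeff_eq_of_kernel _ _ ((2 * h') • cplx m p.1)]
  · rw [radialForm_apply]
    simp only [inner_smul_right, real_inner_self_eq_norm_sq, norm_cplx]
    ring
  · intro u
    rw [dOne_radialForm p hh]
    simp only [map_smul, cplx_cplx, inner_smul_left, inner_smul_right, inner_neg_left,
      inner_self_cplx, RCLike.conj_to_real]
    ring
  · intro u v
    rw [dOne_radialForm p hh, ← inner_cplx_left]
    ring

/-- The Reeb vector field of the radial form is tangent to the spheres. -/
theorem reeb_radialForm {h : ℝ → ℝ} {h' : ℝ} (p v : Eucl m × ℝ)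
    (hh : HasDerivAt h h' (‖p.1‖ ^ 2)) (hv : radialForm h p v = 1)
    (hker : ∀ u, dOne (radialForm h) p ![v, u] = 0) :
    inner ℝ p.1 v.1 = 0 ∧ v.2 * (1 - h (‖p.1‖ ^ 2) + ‖p.1‖ ^ 2 * h') = 1 := by
  have h1 : cplx m v.1 = (-2 * h' * v.2) • p.1 := by
    refine ext_inner_right ℝ fun u => ?_
    have := hker (u, 0)
    rw [dOne_radialForm p hh] at this
    simp only [inner_smul_left, RCLike.conj_to_real]
    simp only [mul_zero, zero_sub] at this
    linarith
  have h2 : v.1 = (2 * h' * v.2) • cplx m p.1 := by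
    have h3 := congrArg (cplx m) h1
    rw [cplx_cplx, map_smul] at h3
    rw [← neg_neg v.1, h3, ← neg_smul]
    congr 1
    ring
  refine ⟨by rw [h2, inner_smul_right, inner_self_cplx, mul_zero], ?_⟩
  rw [radialForm_apply, h2] at hv
  simp only [inner_smul_right, real_inner_self_eq_norm_sq, norm_cplx] at hv
  linarith

/-! ### Rotations -/

/-- Rotation of all complex coordinates by the angle `θ`. -/
def rot (m : ℕ) (θ : ℝ) : Eucl m →L[ℝ] Eucl m :=
  Real.cos θ • ContinuousLinearMap.id ℝ (Eucl m) + Real.sin θ • cplx m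

theorem rot_apply (θ : ℝ) (z : Eucl m) : rot m θ z = Real.cos θ • z + Real.sin θ • cplx m z := by
  simp [rot]

@[simp] theorem rot_zero (z : Eucl m) : rot m 0 z = z := by
  simp [rot_apply]

theorem rot_add (θ η : ℝ) (z : Eucl m) : rot m (θ + η) z = rot m θ (rot m η z) := by
  simp only [rot_apply, map_add, map_smul, cplx_cplx, Real.cos_add, Real.sin_add]
  module

@[simp] theorem rot_two_pi_mul_int (k : ℤ) (z : Eucl m) : rot m (k * (2 * Real.pi)) z = z := by
  have h : Real.sin (k * (2 * Real.pi)) = 0 := by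
    rw [← Real.sin_int_mul_pi (2 * k)]
    push_cast
    ring_nf
  simp [rot_apply, Real.cos_int_mul_two_pi, h]

theorem cplx_rot (θ : ℝ) (z : Eucl m) : cplx m (rot m θ z) = rot m θ (cplx m z) := by
  simp [rot_apply]

@[simp] theorem inner_rot_rot (θ : ℝ) (u v : Eucl m) :
    inner ℝ (rot m θ u) (rot m θ v) = inner ℝ u v := by
  simp only [rot_apply, inner_add_left, inner_add_right, inner_smul_left, inner_smul_right,
    RCLike.conj_to_real, inner_cplx_cplx, inner_cplx_comm u v]
  linear_combination inner ℝ u v * Real.sin_sq_add_cos_sq θ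

@[simp] theorem norm_rot (θ : ℝ) (z : Eucl m) : ‖rot m θ z‖ = ‖z‖ := by
  rw [norm_eq_sqrt_real_inner, inner_rot_rot, ← norm_eq_sqrt_real_inner]

@[simp] theorem rot_neg_rot (θ : ℝ) (z : Eucl m) : rot m (-θ) (rot m θ z) = z := by
  rw [← rot_add, neg_add_cancel, rot_zero]

@[simp] theorem rot_rot_neg (θ : ℝ) (z : Eucl m) : rot m θ (rot m (-θ) z) = z := by
  rw [← rot_add, add_neg_cancel, rot_zero]

/-- `rot m θ` as a linear isometry. -/
def rotIso (m : ℕ) (θ : ℝ) : Eucl m ≃ₗᵢ[ℝ] Eucl m where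
  toFun := rot m θ
  invFun := rot m (-θ)
  map_add' := map_add _
  map_smul' := map_smul _
  left_inv := rot_neg_rot θ
  right_inv := rot_rot_neg θ
  norm_map' := norm_rot θ

/-- An isometry preserves the volume of the closed unit ball, which is neither zero nor infinite.
The absolute value suffices since only absolute densities are computed. -/
theorem abs_det_rot (θ : ℝ) : |LinearMap.det (rot m θ : Eucl m →ₗ[ℝ] Eucl m)| = 1 := by
  have h := (rotIso m θ).measurePreserving.measure_preimage
    (measurableSet_closedBall (x := (0 : Eucl m)) (ε := 1)).nullMeasurableSet
  have hdet : LinearMap.det (rot m θ : Eucl m →ₗ[ℝ] Eucl m) ≠ 0 :=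
    (LinearEquiv.isUnit_det' (rotIso m θ).toLinearEquiv).ne_zero
  have h2 := Measure.addHaar_preimage_linearMap (volume : Measure (Eucl m)) hdet
    (Metric.closedBall 0 1)
  have h3 : (volume (Metric.closedBall (0 : Eucl m) 1)) ≠ 0 :=
    (Metric.measure_closedBall_pos _ _ one_pos).ne'
  have h4 : (volume (Metric.closedBall (0 : Eucl m) 1)) ≠ ⊤ := measure_closedBall_lt_top.ne
  have h5 : ENNReal.ofReal |(LinearMap.det (rot m θ : Eucl m →ₗ[ℝ] Eucl m))⁻¹| = 1 := by
    have h6 := h2.symm.trans h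
    rwa [ENNReal.mul_eq_right h3 h4] at h6
  rw [ENNReal.ofReal_eq_one, abs_inv, inv_eq_one] at h5
  exact h5

theorem hasDerivAt_rot (θ : ℝ) : HasDerivAt (fun θ => rot m θ)
    ((rot m θ).comp (cplx m)) θ := by
  have h := ((Real.hasDerivAt_cos θ).smul_const (ContinuousLinearMap.id ℝ (Eucl m))).add
    ((Real.hasDerivAt_sin θ).smul_const (cplx m))
  refine h.congr_deriv ?_
  ext z : 1
  simp [rot_apply]
  module

theorem contDiff_rot : ContDiff ℝ ∞ (fun θ => rot m θ) := by
  unfold rot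
  exact (Real.contDiff_cos.smul contDiff_const).add (Real.contDiff_sin.smul contDiff_const)

/-! ### Rotating and tube coordinates -/

/-- The function `s + f(z)`. -/
def height (f : Eucl m → ℝ) (p : Eucl m × ℝ) : ℝ := p.2 + f p.1

/-- The differential of `height f` when `df = lam - λ₀`. -/
def dHeight (lam : Eucl m → (Eucl m →L[ℝ] ℝ)) (p : Eucl m × ℝ) : Eucl m × ℝ →L[ℝ] ℝ :=
  ContinuousLinearMap.snd ℝ (Eucl m) ℝ +
    (lam p.1 - liouville m p.1).comp (ContinuousLinearMap.fst ℝ (Eucl m) ℝ)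

/-- The first component in the frame that rotates with angular speed `τ` with respect to
`height f`. -/
def spin (τ : ℝ) (f : Eucl m → ℝ) (p : Eucl m × ℝ) : Eucl m :=
  rot m (-(τ * height f p)) p.1

/-- The differential of `spin τ f` when `df = lam - λ₀`. -/
def dSpin (τ : ℝ) (lam : Eucl m → (Eucl m →L[ℝ] ℝ)) (f : Eucl m → ℝ) (p : Eucl m × ℝ) :
    Eucl m × ℝ →L[ℝ] Eucl m :=
  (rot m (-(τ * height f p))).comp
    (ContinuousLinearMap.fst ℝ (Eucl m) ℝ - (dHeight lam p).smulRight (τ • cplx m p.1))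

/-- The linear function whose differential is the difference of the radial primitives of `ω`
centred at `0` and at `c`. -/
def linForm (c : Eucl m) : Eucl m →L[ℝ] ℝ := liouville m c

/-- The coordinates of the tube with centre `c`. -/
def tubeMap (τ : ℝ) (c : Eucl m) (b : ℝ) (f : Eucl m → ℝ) (p : Eucl m × ℝ) : Eucl m × ℝ :=
  (spin τ f p - c, b * height f p + linForm c (spin τ f p))

/-- The differential of the second component of `tubeMap`. -/
def dAngle (τ : ℝ) (c : Eucl m) (b : ℝ) (lam : Eucl m → (Eucl m →L[ℝ] ℝ)) (f : Eucl m → ℝ)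
    (p : Eucl m × ℝ) : Eucl m × ℝ →L[ℝ] ℝ :=
  b • dHeight lam p + (linForm c).comp (dSpin τ lam f p)

/-- The differential of `tubeMap`. -/
def dTubeMap (τ : ℝ) (c : Eucl m) (b : ℝ) (lam : Eucl m → (Eucl m →L[ℝ] ℝ)) (f : Eucl m → ℝ)
    (p : Eucl m × ℝ) : Eucl m × ℝ →L[ℝ] Eucl m × ℝ :=
  (dSpin τ lam f p).prod (dAngle τ c b lam f p)

section Derivatives

variable {lam : Eucl m → (Eucl m →L[ℝ] ℝ)} {f : Eucl m → ℝ} {p : Eucl m × ℝ}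

theorem dHeight_apply (v : Eucl m × ℝ) :
    dHeight lam p v = v.2 + (lam p.1 v.1 - 1 / 2 * inner ℝ (cplx m p.1) v.1) := by
  simp [dHeight]

theorem dSpin_apply (τ : ℝ) (v : Eucl m × ℝ) :
    dSpin τ lam f p v =
      rot m (-(τ * height f p)) (v.1 - dHeight lam p v • (τ • cplx m p.1)) := by
  simp [dSpin]

theorem hasFDerivAt_height (hf : HasFDerivAt f (lam p.1 - liouville m p.1) p.1) :
    HasFDerivAt (height f) (dHeight lam p) p :=
  hasFDerivAt_snd.add (hf.comp p hasFDerivAt_fst)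

theorem hasFDerivAt_spin (τ : ℝ) (hf : HasFDerivAt f (lam p.1 - liouville m p.1) p.1) :
    HasFDerivAt (spin τ f) (dSpin τ lam f p) p := by
  have h1 : HasFDerivAt (fun q => -(τ * height f q)) (-(τ • dHeight lam p)) p :=
    ((hasFDerivAt_height hf).const_mul τ).neg
  have h2 := (hasDerivAt_rot (m := m) (-(τ * height f p))).hasFDerivAt.comp p h1
  have h3 := h2.clm_apply (hasFDerivAt_fst (𝕜 := ℝ) (p := p))
  refine h3.congr_fderiv ?_
  refine ContinuousLinearMap.ext fun v => ?_
  rw [dSpin_apply]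
  simp
  module

theorem hasFDerivAt_tubeMap (τ : ℝ) (c : Eucl m) (b : ℝ)
    (hf : HasFDerivAt f (lam p.1 - liouville m p.1) p.1) :
    HasFDerivAt (tubeMap τ c b f) (dTubeMap τ c b lam f p) p :=
  ((hasFDerivAt_spin τ hf).sub_const c).prodMk
    (((hasFDerivAt_height hf).const_mul b).add
      ((linForm c).hasFDerivAt.comp p (hasFDerivAt_spin τ hf)))

/-- The differential factors into three shears, a rotation, and the scaling of the last coordinate
by `b`. -/
theorem abs_det_dTubeMap (τ : ℝ) (c : Eucl m) (b : ℝ) :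
    |LinearMap.det (dTubeMap τ c b lam f p : Eucl m × ℝ →ₗ[ℝ] Eucl m × ℝ)| = |b| := by
  let fs : Eucl m × ℝ →ₗ[ℝ] Eucl m := LinearMap.fst ℝ (Eucl m) ℝ
  let sn : Eucl m × ℝ →ₗ[ℝ] ℝ := LinearMap.snd ℝ (Eucl m) ℝ
  let R : Eucl m →ₗ[ℝ] Eucl m := rot m (-(τ * height f p))
  let ℓ : Eucl m →ₗ[ℝ] ℝ := lam p.1 - liouville m p.1
  let g : Eucl m →ₗ[ℝ] ℝ := linForm c
  -- Read from right to left: pass from `s` to the height, subtract the rotation speed, rotate,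
  -- scale by `b` (written as a transvection), add the linear function of the centre.
  have key : (dTubeMap τ c b lam f p : Eucl m × ℝ →ₗ[ℝ] Eucl m × ℝ) =
      LinearMap.transvection (g ∘ₗ fs) (0, 1) ∘ₗ LinearMap.transvection ((b - 1) • sn) (0, 1) ∘ₗ
        LinearMap.prodMap R LinearMap.id ∘ₗ
        LinearMap.transvection sn (-(τ • cplx m p.1), 0) ∘ₗ
        LinearMap.transvection (ℓ ∘ₗ fs) (0, 1) := by
    refine LinearMap.ext fun v => ?_
    have e : dHeight lam p v = v.2 + ℓ v.1 := rfl
    simp only [LinearMap.comp_apply, LinearMap.transvection.apply]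
    refine Prod.ext ?_ ?_
    · simp [dTubeMap, dSpin_apply, e, fs, sn, R, smul_neg, sub_eq_add_neg]
    · simp [dTubeMap, dAngle, dSpin_apply, e, fs, sn, R, g, smul_neg, sub_eq_add_neg]
      ring
  rw [key]
  simp only [LinearMap.det_comp, LinearMap.transvection.det, LinearMap.det_prodMap,
    LinearMap.det_id, mul_one, abs_mul]
  rw [abs_det_rot]
  simp [fs, sn, g, ℓ]

/-- The pull-back of a radial form to a tube. -/
theorem radialForm_comp_dTubeMap (τ : ℝ) (c : Eucl m) (b : ℝ) (h : ℝ → ℝ) :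
    (radialForm h (tubeMap τ c b f p)).comp (dTubeMap τ c b lam f p) =
      addDs lam (toTorus p) + (b - 1 - τ / 2 * ‖p.1‖ ^ 2) • dHeight lam p -
        h (‖spin τ f p - c‖ ^ 2) • dAngle τ c b lam f p := by
  refine ContinuousLinearMap.ext fun v => ?_
  -- This is twice the pull-back of `λ₀` by `spin`: the rotating frame costs `(τ/2)|z|² dh`.
  have e : inner ℝ (cplx m (spin τ f p)) (dSpin τ lam f p v) =
      inner ℝ (cplx m p.1) v.1 - dHeight lam p v * (τ * ‖p.1‖ ^ 2) := by
    rw [dSpin_apply, spin, cplx_rot, inner_rot_rot]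
    simp only [inner_sub_right, inner_smul_right, real_inner_self_eq_norm_sq, norm_cplx]
  have e2 : dHeight lam p v = v.2 + (lam p.1 v.1 - 1 / 2 * inner ℝ (cplx m p.1) v.1) :=
    dHeight_apply v
  have e3 : addDs lam (toTorus p) v = lam p.1 v.1 + v.2 := rfl
  have e4 : (dTubeMap τ c b lam f p v).2 =
    b * dHeight lam p v + 1 / 2 * inner ℝ (cplx m c) (dSpin τ lam f p v) := by
    simp [dTubeMap, dAngle, linForm]
  have e5 : dAngle τ c b lam f p v =
    b * dHeight lam p v + 1 / 2 * inner ℝ (cplx m c) (dSpin τ lam f p v) := e4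
  have e6 : (dTubeMap τ c b lam f p v).1 = dSpin τ lam f p v := rfl
  simp only [ContinuousLinearMap.comp_apply, radialForm_apply, e4, e6, tubeMap, map_sub,
    inner_sub_left, _root_.add_apply, _root_.sub_apply,
    _root_.smul_apply, e3, e5, e, smul_eq_mul]
  linear_combination e2

end Derivatives

section Smoothness

variable {r : ℝ} {lam : Eucl m → (Eucl m →L[ℝ] ℝ)} {f : Eucl m → ℝ}

theorem isOpen_coverTorus (m : ℕ) (r : ℝ) : IsOpen (coverTorus m r) :=
  Metric.isOpen_ball.prod isOpen_univ

theorem contDiffOn_comp_fst {F : Type*} [NormedAddCommGroup F] [NormedSpace ℝ F] {g : Eucl m → F}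
    (hg : ContDiffOn ℝ ∞ g (Metric.ball 0 r)) :
    ContDiffOn ℝ ∞ (fun p : Eucl m × ℝ => g p.1) (coverTorus m r) :=
  hg.comp contDiff_fst.contDiffOn fun _ hp => hp.1

theorem contDiffOn_height (hf : ContDiffOn ℝ ∞ f (Metric.ball 0 r)) :
    ContDiffOn ℝ ∞ (height f) (coverTorus m r) :=
  contDiff_snd.contDiffOn.add (contDiffOn_comp_fst hf)

theorem contDiffOn_dHeight (hlam : ContDiffOn ℝ ∞ lam (Metric.ball 0 r)) :
    ContDiffOn ℝ ∞ (dHeight lam) (coverTorus m r) :=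
  contDiffOn_const.add
    ((contDiffOn_comp_fst (hlam.sub (liouville m).contDiff.contDiffOn)).clm_comp contDiffOn_const)

theorem contDiffOn_rot_height (τ : ℝ) (hf : ContDiffOn ℝ ∞ f (Metric.ball 0 r)) :
    ContDiffOn ℝ ∞ (fun p => rot m (-(τ * height f p))) (coverTorus m r) :=
  contDiff_rot.comp_contDiffOn (contDiffOn_const.mul (contDiffOn_height hf)).neg

theorem contDiffOn_spin (τ : ℝ) (hf : ContDiffOn ℝ ∞ f (Metric.ball 0 r)) :
    ContDiffOn ℝ ∞ (spin τ f) (coverTorus m r) :=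
  (contDiffOn_rot_height τ hf).clm_apply contDiff_fst.contDiffOn

theorem contDiffOn_dSpin (τ : ℝ) (hlam : ContDiffOn ℝ ∞ lam (Metric.ball 0 r))
    (hf : ContDiffOn ℝ ∞ f (Metric.ball 0 r)) :
    ContDiffOn ℝ ∞ (dSpin τ lam f) (coverTorus m r) :=
  (contDiffOn_rot_height τ hf).clm_comp (contDiffOn_const.sub
    ((contDiffOn_dHeight hlam).smulRight (g := fun p => τ • cplx m p.1)
      (((τ • cplx m).contDiff.comp contDiff_fst).contDiffOn)))

theorem contDiffOn_dAngle (τ : ℝ) (c : Eucl m) (b : ℝ)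
    (hlam : ContDiffOn ℝ ∞ lam (Metric.ball 0 r)) (hf : ContDiffOn ℝ ∞ f (Metric.ball 0 r)) :
    ContDiffOn ℝ ∞ (dAngle τ c b lam f) (coverTorus m r) :=
  (contDiffOn_const.smul (f := fun _ => b) (contDiffOn_dHeight hlam)).add
    (contDiffOn_const.clm_comp (contDiffOn_dSpin τ hlam hf))

theorem contDiffOn_tubeMap (τ : ℝ) (c : Eucl m) (b : ℝ)
    (hf : ContDiffOn ℝ ∞ f (Metric.ball 0 r)) :
    ContDiffOn ℝ ∞ (tubeMap τ c b f) (coverTorus m r) :=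
  ((contDiffOn_spin τ hf).sub contDiffOn_const).prodMk
    ((contDiffOn_const.mul (contDiffOn_height hf)).add
      ((linForm c).contDiff.comp_contDiffOn (contDiffOn_spin τ hf)))

end Smoothness

/-- A closed difference of primitives is exact on the ball. -/
theorem exists_potential {r : ℝ} {lam : Eucl m → (Eucl m →L[ℝ] ℝ)} (hlam : IsPrimitive m r lam) :
    ∃ f : Eucl m → ℝ, ContDiffOn ℝ ∞ f (Metric.ball 0 r) ∧
      ∀ z ∈ Metric.ball (0 : Eucl m) r, HasFDerivAt f (lam z - liouville m z) z := by
  have hs : ContDiffOn ℝ ∞ (fun z => lam z - liouville m z) (Metric.ball 0 r) :=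
    hlam.1.sub (liouville m).contDiff.contDiffOn
  have hd : ∀ z ∈ Metric.ball (0 : Eucl m) r, DifferentiableAt ℝ lam z := fun z hz =>
    (hlam.1.contDiffAt (Metric.isOpen_ball.mem_nhds hz)).differentiableAt (by simp)
  -- Both forms are primitives of `ω`, so the derivative of their difference is symmetric and the
  -- Poincaré lemma applies on the convex ball.
  obtain ⟨f, hf⟩ := (convex_ball (0 : Eucl m) r).exists_forall_hasFDerivAt_of_fderiv_symmetric
    Metric.isOpen_ball (hs.differentiableOn (by simp)) (by
      intro z hz u v
      have h1 := hlam.2 z hz u v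
      rw [dOne_apply (hd z hz), ← inner_cplx_left] at h1
      rw [fderiv_fun_sub (hd z hz) (liouville m).differentiableAt,
        ContinuousLinearMap.fderiv]
      simp only [_root_.sub_apply, liouville_apply]
      rw [inner_cplx_comm v u, real_inner_comm (cplx m u) v]
      linarith)
  refine ⟨f, ?_, hf⟩
  refine (contDiffOn_infty_iff_fderiv_of_isOpen Metric.isOpen_ball).2
    ⟨fun z hz => (hf z hz).differentiableAt.differentiableWithinAt, hs.congr fun z hz => ?_⟩
  exact (hf z hz).fderiv

/-! ### Cutoff functions and profiles -/

/-- A smooth function that is `1` on `(-∞, A]` and `0` on `[B, ∞)`. -/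
def cutoff (A B ρ : ℝ) : ℝ := Real.smoothTransition ((B - ρ) / (B - A))

/-- The compactly supported primitive of `-cutoff A B`. -/
def profile (A B ρ : ℝ) : ℝ := ∫ t in ρ..B, cutoff A B t

section Profile

variable {A B ρ : ℝ}

theorem contDiff_cutoff : ContDiff ℝ ∞ (cutoff A B) :=
  Real.smoothTransition.contDiff.comp ((contDiff_const.sub contDiff_id).div_const _)

theorem cutoff_nonneg : 0 ≤ cutoff A B ρ := Real.smoothTransition.nonneg _

theorem cutoff_le_one : cutoff A B ρ ≤ 1 := Real.smoothTransition.le_one _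

theorem cutoff_of_le (hAB : A < B) (h : ρ ≤ A) : cutoff A B ρ = 1 :=
  Real.smoothTransition.one_of_one_le ((one_le_div (sub_pos.2 hAB)).2 (by linarith))

theorem cutoff_of_ge (hAB : A < B) (h : B ≤ ρ) : cutoff A B ρ = 0 :=
  Real.smoothTransition.zero_of_nonpos
    (div_nonpos_of_nonpos_of_nonneg (by linarith) (by linarith))

theorem intervalIntegrable_cutoff (a b : ℝ) :
    IntervalIntegrable (cutoff A B) volume a b :=
  contDiff_cutoff.continuous.intervalIntegrable a b

theorem hasDerivAt_profile : HasDerivAt (profile A B) (-cutoff A B ρ) ρ :=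
  intervalIntegral.integral_hasDerivAt_left (intervalIntegrable_cutoff _ _)
    contDiff_cutoff.continuous.aestronglyMeasurable.stronglyMeasurableAtFilter
    contDiff_cutoff.continuous.continuousAt

theorem contDiff_profile : ContDiff ℝ ∞ (profile A B) := by
  refine contDiff_infty_iff_deriv.2 ⟨fun ρ => hasDerivAt_profile.differentiableAt, ?_⟩
  rw [show deriv (profile A B) = fun ρ => -cutoff A B ρ from
    funext fun ρ => hasDerivAt_profile.deriv]
  exact contDiff_cutoff.neg

theorem profile_of_ge (hAB : A < B) (h : B ≤ ρ) : profile A B ρ = 0 := by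
  rw [profile, intervalIntegral.integral_congr (g := fun _ => 0)]
  · simp
  · intro t ht
    rw [uIcc_of_ge h] at ht
    exact cutoff_of_ge hAB ht.1

theorem profile_nonneg (hAB : A < B) : 0 ≤ profile A B ρ := by
  rcases le_total B ρ with h | h
  · rw [profile_of_ge hAB h]
  · exact intervalIntegral.integral_nonneg h fun t _ => cutoff_nonneg

theorem profile_le (h : ρ ≤ B) : profile A B ρ ≤ B - ρ := by
  have := intervalIntegral.integral_mono_on h (intervalIntegrable_cutoff (A := A) (B := B) ρ B)
    (intervalIntegrable_const (c := (1 : ℝ))) fun t _ => cutoff_le_one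
  simpa [profile] using this

/-- The cutoff is `1` between the two points. That the profile is exactly affine here makes the
return map an exact rotation. -/
theorem profile_sub_profile (hAB : A < B) {σ : ℝ} (hσ : σ ≤ A) (hρ : ρ ≤ A) :
    profile A B ρ = profile A B σ + (σ - ρ) := by
  rw [profile, profile, ← intervalIntegral.integral_add_adjacent_intervals
    (intervalIntegrable_cutoff ρ σ) (intervalIntegrable_cutoff σ B), add_comm,
    intervalIntegral.integral_congr (a := ρ) (b := σ) (g := fun _ => 1)]
  · simp
  · intro t ht
    exact cutoff_of_le hAB (ht.2.trans (max_le hρ hσ))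

/-- For `g = profile A B` the quantity is `g - ρ g'`, the amount by which the perturbation `g`
lowers the density factor `1 - g + ρ g'`. This bound and the next two control the volume and the
Reeb speed. -/
theorem profile_add_mul_nonneg (hAB : A < B) (h : 0 ≤ ρ) :
    0 ≤ profile A B ρ + ρ * cutoff A B ρ :=
  add_nonneg (profile_nonneg hAB) (mul_nonneg h cutoff_nonneg)

theorem profile_add_mul_le (hB : 0 ≤ B) (hAB : A < B) (h : 0 ≤ ρ) :
    profile A B ρ + ρ * cutoff A B ρ ≤ B := by
  rcases le_total B ρ with h' | h'
  · rw [profile_of_ge hAB h', cutoff_of_ge hAB h']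
    linarith
  · have h1 := profile_le (A := A) h'
    have h2 := mul_le_mul_of_nonneg_left (cutoff_le_one (A := A) (B := B) (ρ := ρ)) h
    linarith

theorem le_profile_add_mul (hAB : A < B) (hρ : ρ ≤ A) :
    A ≤ profile A B ρ + ρ * cutoff A B ρ := by
  rw [profile_sub_profile hAB le_rfl hρ, cutoff_of_le hAB hρ]
  linarith [profile_nonneg (ρ := A) hAB]

end Profile

/-! ### Packing the ball equivariantly by balls -/

/-- A finite family of disjoint closed balls (given by centres and radii) in the ball of radius `r`
that is invariant under rotation by `2π/n`, such that the rotations of order `n` permute the balls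
freely. -/
structure IsPacking (n : ℕ) (r : ℝ) (P : Finset (Eucl m × ℝ)) : Prop where
  pos : ∀ q ∈ P, 0 < q.2
  subset : ∀ q ∈ P, Metric.closedBall q.1 q.2 ⊆ Metric.ball 0 r
  disjoint : (P : Set (Eucl m × ℝ)).PairwiseDisjoint fun q => Metric.closedBall q.1 q.2
  rot_mem : ∀ q ∈ P, (rot m (2 * Real.pi / n) q.1, q.2) ∈ P
  dvd : ∀ q ∈ P, ∀ k : ℤ, ∀ w ∈ Metric.closedBall q.1 q.2,
    rot m (k * (2 * Real.pi / n)) w ∈ Metric.closedBall q.1 q.2 → (n : ℤ) ∣ k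

theorem dist_rot_rot (θ : ℝ) (x y : Eucl m) : dist (rot m θ x) (rot m θ y) = dist x y :=
  (rotIso m θ).dist_map x y

theorem volume_preimage_rot (θ : ℝ) {s : Set (Eucl m)} (hs : NullMeasurableSet s volume) :
    volume (rot m θ ⁻¹' s) = volume s :=
  (rotIso m θ).measurePreserving.measure_preimage hs

theorem rot_int_add_mul {n : ℕ} (hn : 0 < n) (j k : ℤ) (z : Eucl m) :
    rot m (((j + n * k : ℤ) : ℝ) * (2 * Real.pi / n)) z = rot m (j * (2 * Real.pi / n)) z := by
  have hn' : (n : ℝ) ≠ 0 := by positivity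
  have : ((j + n * k : ℤ) : ℝ) * (2 * Real.pi / n) =
      j * (2 * Real.pi / n) + k * (2 * Real.pi) := by
    push_cast
    field_simp
  rw [this, rot_add, rot_two_pi_mul_int]

theorem rot_int_emod {n : ℕ} (hn : 0 < n) (k : ℤ) (z : Eucl m) :
    rot m (((k % n : ℤ) : ℝ) * (2 * Real.pi / n)) z = rot m (k * (2 * Real.pi / n)) z := by
  conv_rhs => rw [← Int.emod_add_mul_ediv k n]
  rw [rot_int_add_mul hn]

theorem rot_int_rot {n : ℕ} (j k : ℤ) (z : Eucl m) :
    rot m (j * (2 * Real.pi / n)) (rot m (k * (2 * Real.pi / n)) z) =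
      rot m (((j + k : ℤ) : ℝ) * (2 * Real.pi / n)) z := by
  rw [← rot_add]
  push_cast
  ring_nf

/-- A Dirichlet domain for the action of the rotations of order `n`. -/
def sector (n : ℕ) (i : Fin m) : Set (Eucl m) :=
  {w | ∀ k : ℤ, 0 < k → k < n → rot m (k * (2 * Real.pi / n)) w (i, 0) < w (i, 0)}

theorem isOpen_sector (n : ℕ) (i : Fin m) : IsOpen (sector n i) := by
  have : sector n i = ⋂ k ∈ Ioo (0 : ℤ) n,
      {w : Eucl m | rot m (k * (2 * Real.pi / n)) w (i, 0) < w (i, 0)} := by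
    ext w
    simp [sector]
  rw [this]
  refine (Set.finite_Ioo (0 : ℤ) n).isOpen_biInter fun k _ => ?_
  exact isOpen_lt (by fun_prop) (by fun_prop)

/-- If `k` is not a multiple of `n`, then `w` has strictly larger `i`-th real part than its rotated
point; since turning on by `n - k % n` steps leads back to `w`, the opposite inequality holds too.
-/
theorem dvd_of_mem_sector {n : ℕ} (hn : 0 < n) {i : Fin m} {w : Eucl m} (hw : w ∈ sector n i)
    {k : ℤ} (hk : rot m (k * (2 * Real.pi / n)) w ∈ sector n i) : (n : ℤ) ∣ k := by
  rw [← rot_int_emod hn] at hk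
  have hn' : (0 : ℤ) < n := by exact_mod_cast hn
  have h0 := Int.emod_nonneg k hn'.ne'
  have h1 := Int.emod_lt_of_pos k hn'
  by_contra hdvd
  have h2 : 0 < k % n := lt_of_le_of_ne h0 fun h => hdvd (Int.dvd_of_emod_eq_zero h.symm)
  have h3 := hw _ h2 h1
  have h4 := hk (n - k % n) (by omega) (by omega)
  rw [rot_int_rot, sub_add_cancel] at h4
  have h5 := rot_int_add_mul hn 0 1 w
  simp only [zero_add, mul_one, Int.cast_zero, zero_mul, rot_zero] at h5
  rw [h5] at h4
  linarith

/-- The points with two rotations that have the same `i`-th real part. -/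
def ties (n : ℕ) (i : Fin m) : Set (Eucl m) :=
  ⋃ jk ∈ {jk : ℤ × ℤ | jk ∈ Ico (0 : ℤ) n ×ˢ Ico (0 : ℤ) n ∧ jk.1 ≠ jk.2},
    {w | rot m (jk.1 * (2 * Real.pi / n)) w (i, 0) = rot m (jk.2 * (2 * Real.pi / n)) w (i, 0)}

/-- Among the `n` rotated points one has maximal `i`-th real part, and without ties the maximum is
strict. -/
theorem exists_rot_mem_sector {n : ℕ} (hn : 0 < n) {i : Fin m} {w : Eucl m} (hw : w ∉ ties n i) :
    ∃ k ∈ Finset.Ico (0 : ℤ) n, rot m (k * (2 * Real.pi / n)) w ∈ sector n i := by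
  have hn' : (0 : ℤ) < n := by exact_mod_cast hn
  obtain ⟨k, hk, hmax⟩ := (Finset.Ico (0 : ℤ) n).exists_max_image
    (fun k : ℤ => rot m (k * (2 * Real.pi / n)) w (i, 0)) ⟨0, by simpa using hn⟩
  refine ⟨k, hk, fun l hl hln => ?_⟩
  rw [rot_int_rot, ← rot_int_emod hn]
  have h0 := Int.emod_nonneg (l + k) hn'.ne'
  have h1 := Int.emod_lt_of_pos (l + k) hn'
  refine lt_of_le_of_ne (hmax _ (Finset.mem_Ico.2 ⟨h0, h1⟩)) fun h => hw ?_
  refine mem_iUnion₂.2 ⟨((l + k) % n, k), ⟨⟨⟨h0, h1⟩, Finset.mem_Ico.1 hk⟩, fun he => ?_⟩, h⟩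
  simp only at he
  have h2 := Int.emod_add_mul_ediv (l + k) n
  have h3 : l = n * ((l + k) / n) := by omega
  exact absurd (Int.le_of_dvd hl ⟨_, h3⟩) (by omega)

/-- The set is a finite union of kernels of linear forms. A form vanishing identically would, on the
two basis vectors of the `i`-th plane, equate the cosines and sines of two angles that differ modulo
`2π`. -/
theorem volume_ties {n : ℕ} (hn : 0 < n) (i : Fin m) : volume (ties n i) = 0 := by
  have hfin : {jk : ℤ × ℤ | jk ∈ Ico (0 : ℤ) n ×ˢ Ico (0 : ℤ) n ∧ jk.1 ≠ jk.2}.Finite :=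
    ((Set.finite_Ico _ _).prod (Set.finite_Ico _ _)).subset fun _ h => h.1
  refine (measure_biUnion_null_iff hfin.countable).2 fun ⟨j, k⟩ ⟨⟨hj, hk⟩, hjk⟩ => ?_
  let ℓ : Eucl m →ₗ[ℝ] ℝ := (EuclideanSpace.proj (i, 0)).comp
    (rot m (j * (2 * Real.pi / n)) - rot m (k * (2 * Real.pi / n)))
  have hset : {w | rot m (j * (2 * Real.pi / n)) w (i, 0) = rot m (k * (2 * Real.pi / n)) w (i, 0)}
      = (LinearMap.ker ℓ : Set (Eucl m)) := by
    ext w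
    simp [ℓ, sub_eq_zero]
  refine (congrArg volume hset).trans (Measure.addHaar_submodule _ _ fun htop => hjk ?_)
  have hℓ : ∀ w : Eucl m, rot m (j * (2 * Real.pi / n)) w (i, 0) =
      rot m (k * (2 * Real.pi / n)) w (i, 0) := fun w => by
    have : w ∈ (LinearMap.ker ℓ : Set (Eucl m)) := by rw [htop]; trivial
    rwa [← hset] at this
  have h0 : Real.cos (j * (2 * Real.pi / n)) = Real.cos (k * (2 * Real.pi / n)) := by
    simpa [rot_apply] using hℓ (EuclideanSpace.single (i, 0) 1)
  have h1 : Real.sin (j * (2 * Real.pi / n)) = Real.sin (k * (2 * Real.pi / n)) := by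
    simpa [rot_apply] using hℓ (EuclideanSpace.single (i, 1) 1)
  have hang := Real.Angle.cos_sin_inj (θ := j * (2 * Real.pi / n)) (ψ := k * (2 * Real.pi / n))
    h0 h1
  obtain ⟨z, hz⟩ := Real.Angle.angle_eq_iff_two_pi_dvd_sub.1 hang
  have hn' : (n : ℝ) ≠ 0 := by positivity
  have hpi := Real.pi_ne_zero
  field_simp at hz
  have hz' : j - k = n * z := by
    have : (j : ℝ) - k = n * z := by linarith
    exact_mod_cast this
  have h2 : (n : ℤ) ∣ j - k := ⟨z, hz'⟩
  have h3 := Int.eq_zero_of_abs_lt_dvd h2 (by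
    rw [abs_lt]
    exact ⟨by linarith [hj.1, hk.2], by linarith [hj.2, hk.1]⟩)
  show j = k
  omega

/-- Vitali covering by finitely many balls. -/
theorem exists_finite_disjoint_closedBall_cover {s : Set (Eucl m)} (hs : IsOpen s)
    (hs' : volume s ≠ ⊤) {ε : ℝ≥0∞} (hε : ε ≠ 0) :
    ∃ (J : Finset (Eucl m)) (ρ : Eucl m → ℝ), (∀ x ∈ J, 0 < ρ x) ∧
      (∀ x ∈ J, Metric.closedBall x (ρ x) ⊆ s) ∧
      (J : Set (Eucl m)).PairwiseDisjoint (fun x => Metric.closedBall x (ρ x)) ∧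
      volume (s \ ⋃ x ∈ J, Metric.closedBall x (ρ x)) < ε := by
  obtain ⟨t, ρ, htc, -, hρ, hcov, hdisj⟩ := Besicovitch.exists_disjoint_closedBall_covering_ae
    (volume : Measure (Eucl m)) (fun x => {ρ | Metric.closedBall x ρ ⊆ s}) s (by
      intro x hx δ hδ
      obtain ⟨η, hη, hηs⟩ := Metric.nhds_basis_closedBall.mem_iff.1 (hs.mem_nhds hx)
      refine ⟨min η (δ / 2), ?_, lt_min hη (by linarith), (min_le_right _ _).trans_lt (by linarith)⟩
      exact (Metric.closedBall_subset_closedBall (min_le_left _ _)).trans hηs)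
    (fun _ => 1) fun _ _ => one_pos
  have : Countable t := htc.to_subtype
  let g : Finset t → Set (Eucl m) := fun F => s \ ⋃ x ∈ F, Metric.closedBall (x : Eucl m) (ρ x)
  have hg : Antitone g := fun F G hFG =>
    sdiff_subset_sdiff_right (biUnion_subset_biUnion_left hFG)
  have hgm : ∀ F, NullMeasurableSet (g F) volume := fun F =>
    (hs.measurableSet.diff
      (F.measurableSet_biUnion fun x _ => measurableSet_closedBall)).nullMeasurableSet
  -- Continuity from above over the finite subfamilies turns the countable covering up to a null set
  -- into a finite one up to `ε`.
  have htend := tendsto_measure_iInter_atTop (μ := volume) hgm hg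
    ⟨∅, ne_top_of_le_ne_top hs' (measure_mono sdiff_subset)⟩
  have hinter : volume (⋂ F, g F) = 0 := by
    refine measure_mono_null (fun w hw => ?_) hcov
    rw [mem_iInter] at hw
    refine ⟨(hw ∅).1, fun h => ?_⟩
    obtain ⟨x, hx, hwx⟩ := mem_iUnion₂.1 h
    exact (hw {⟨x, hx⟩}).2 (by simpa using hwx)
  rw [hinter] at htend
  obtain ⟨F, hF⟩ := (htend.eventually (gt_mem_nhds (pos_iff_ne_zero.2 hε))).exists
  refine ⟨F.map (Function.Embedding.subtype _), ρ, ?_, ?_, ?_, ?_⟩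
  · intro x hx
    obtain ⟨y, -, rfl⟩ := Finset.mem_map.1 hx
    exact (hρ y y.2).2.1
  · intro x hx
    obtain ⟨y, -, rfl⟩ := Finset.mem_map.1 hx
    exact (hρ y y.2).1
  · refine hdisj.subset fun x hx => ?_
    obtain ⟨y, -, rfl⟩ := Finset.mem_map.1 hx
    exact y.2
  · simpa [g] using hF

/-- Up to a null set the sector is a fundamental domain of the rotation group of order `n`. Its part
of the ball is filled by balls up to volume `ε / n`, and the filling is copied by the `n` rotations.
As the balls lie in the sector, distinct copies are disjoint and no rotated ball meets itself again
before a full turn. -/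
theorem exists_packing {n : ℕ} (hn : 0 < n) (hm : 1 ≤ m) (r : ℝ) {ε : ℝ≥0∞} (hε : ε ≠ 0) :
    ∃ P : Finset (Eucl m × ℝ), IsPacking n r P ∧
      volume (Metric.ball 0 r \ ⋃ q ∈ P, Metric.closedBall q.1 q.2) < ε := by
  classical
  let i : Fin m := ⟨0, hm⟩
  have hn' : (0 : ℤ) < n := by exact_mod_cast hn
  obtain ⟨J, ρ, hρ, hJs, hJd, hJv⟩ := exists_finite_disjoint_closedBall_cover
    (s := sector n i ∩ Metric.ball 0 r) ((isOpen_sector n i).inter Metric.isOpen_ball)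
    (ne_top_of_le_ne_top measure_ball_lt_top.ne (measure_mono inter_subset_right))
    (ε := ε / n) (ENNReal.div_ne_zero.2 ⟨hε, ENNReal.natCast_ne_top n⟩)
  let τ : ℝ := 2 * Real.pi / n
  let P : Finset (Eucl m × ℝ) := (J ×ˢ Finset.Ico (0 : ℤ) n).image
    fun xk => (rot m (xk.2 * τ) xk.1, ρ xk.1)
  have hP : ∀ q ∈ P, ∃ x ∈ J, ∃ k : ℤ, 0 ≤ k ∧ k < n ∧ q = (rot m (k * τ) x, ρ x) := by
    intro q hq
    obtain ⟨⟨x, k⟩, hxk, rfl⟩ := Finset.mem_image.1 hq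
    rw [Finset.mem_product, Finset.mem_Ico] at hxk
    exact ⟨x, hxk.1, k, hxk.2.1, hxk.2.2, rfl⟩
  have hP' : ∀ x ∈ J, ∀ k : ℤ, (rot m (k * τ) x, ρ x) ∈ P := by
    intro x hx k
    refine Finset.mem_image.2 ⟨(x, k % n), ?_, ?_⟩
    · rw [Finset.mem_product, Finset.mem_Ico]
      exact ⟨hx, Int.emod_nonneg k hn'.ne', Int.emod_lt_of_pos k hn'⟩
    · simp only [τ, rot_int_emod hn]
  have hball : ∀ (x w : Eucl m) (k : ℤ) (ρ' : ℝ),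
      w ∈ Metric.closedBall (rot m (k * τ) x) ρ' ↔
        rot m (((-k : ℤ) : ℝ) * τ) w ∈ Metric.closedBall x ρ' := by
    intro x w k ρ'
    rw [Metric.mem_closedBall, Metric.mem_closedBall, ← dist_rot_rot (((-k : ℤ) : ℝ) * τ) w,
      rot_int_rot]
    simp
  refine ⟨P, ⟨?_, ?_, ?_, ?_, ?_⟩, ?_⟩
  · intro q hq
    obtain ⟨x, hx, k, -, -, rfl⟩ := hP q hq
    exact hρ x hx
  · intro q hq w hw
    obtain ⟨x, hx, k, -, -, rfl⟩ := hP q hq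
    have := (hJs x hx ((hball x w k _).1 hw)).2
    simpa using this
  · intro q hq q' hq' hne
    obtain ⟨x, hx, k, hk0, hkn, rfl⟩ := hP q hq
    obtain ⟨y, hy, l, hl0, hln, rfl⟩ := hP q' hq'
    refine Set.disjoint_left.2 fun w hw hw' => hne ?_
    have h1 := (hball x w k _).1 hw
    have h2 := (hball y w l _).1 hw'
    have h3 := dvd_of_mem_sector hn (k := k - l) (hJs x hx h1).1 (by
      rw [rot_int_rot, show k - l + -k = -l by ring]
      exact (hJs y hy h2).1)
    have h4 := Int.eq_zero_of_abs_lt_dvd h3 (by rw [abs_lt]; constructor <;> omega)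
    obtain rfl : k = l := by omega
    obtain rfl : x = y := by
      by_contra hxy
      exact Set.disjoint_left.1 (hJd hx hy hxy) h1 h2
    rfl
  · intro q hq
    obtain ⟨x, hx, k, -, -, rfl⟩ := hP q hq
    have := hP' x hx (1 + k)
    rw [← rot_int_rot, Int.cast_one, one_mul] at this
    exact this
  · intro q hq k w hw hw'
    obtain ⟨x, hx, l, -, -, rfl⟩ := hP q hq
    have h1 := (hball x w l _).1 hw
    have h2 := (hball x _ l _).1 hw'
    refine dvd_of_mem_sector hn (hJs x hx h1).1 ?_
    rw [rot_int_rot, add_comm, ← rot_int_rot]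
    exact (hJs x hx h2).1
  · let s' : Set (Eucl m) := (sector n i ∩ Metric.ball 0 r) \ ⋃ x ∈ J, Metric.closedBall x (ρ x)
    have hsub : Metric.ball 0 r \ ⋃ q ∈ P, Metric.closedBall q.1 q.2 ⊆
        ties n i ∪ ⋃ k ∈ Finset.Ico (0 : ℤ) n, rot m (k * τ) ⁻¹' s' := by
      rintro w ⟨hwr, hwP⟩
      by_cases hw : w ∈ ties n i
      · exact Or.inl hw
      obtain ⟨k, hk, hks⟩ := exists_rot_mem_sector hn hw
      refine Or.inr (mem_iUnion₂.2 ⟨k, hk, ⟨hks, by simpa using hwr⟩, fun h => hwP ?_⟩)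
      obtain ⟨x, hx, hwx⟩ := mem_iUnion₂.1 h
      refine mem_iUnion₂.2 ⟨_, hP' x hx (-k), (hball x w (-k) _).2 ?_⟩
      simpa using hwx
    have hs'm : NullMeasurableSet s' volume :=
      ((((isOpen_sector n i).inter Metric.isOpen_ball).measurableSet).diff
        (J.measurableSet_biUnion fun x _ => measurableSet_closedBall)).nullMeasurableSet
    calc volume (Metric.ball 0 r \ ⋃ q ∈ P, Metric.closedBall q.1 q.2)
        ≤ volume (ties n i) + ∑ k ∈ Finset.Ico (0 : ℤ) n, volume (rot m (k * τ) ⁻¹' s') :=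
          (measure_mono hsub).trans ((measure_union_le _ _).trans
            (add_le_add_right (measure_biUnion_finset_le _ _) _))
      _ = n * volume s' := by
          rw [volume_ties hn, zero_add, Finset.sum_congr rfl fun (k : ℤ) _ =>
            volume_preimage_rot (k * τ) hs'm]
          simp
      _ < ε := by
          rw [mul_comm]
          exact ENNReal.mul_lt_of_lt_div hJv

/-- As `θ` tends to `1`, the uncovered set decreases to one that exceeds the original uncovered set
at most by spheres, which are null. -/
theorem exists_shrink {r : ℝ} {P : Finset (Eucl m × ℝ)} (hP : ∀ q ∈ P, 0 < q.2) {ε : ℝ≥0∞}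
    (hv : volume (Metric.ball 0 r \ ⋃ q ∈ P, Metric.closedBall q.1 q.2) < ε) (η : ℝ) (hη : 0 < η) :
    ∃ θ : ℝ, 0 < θ ∧ θ < 1 ∧ 1 - θ < η ∧
      volume (Metric.ball 0 r \ ⋃ q ∈ P, Metric.closedBall q.1 (θ * q.2)) < ε := by
  let u : ℕ → ℝ := fun k => 1 - 1 / (k + 2)
  let g : ℕ → Set (Eucl m) := fun k => Metric.ball 0 r \ ⋃ q ∈ P, Metric.closedBall q.1 (u k * q.2)
  have hu : Monotone u := fun j k hjk =>
    sub_le_sub_left (one_div_le_one_div_of_le (by positivity) (by gcongr)) _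
  have hu1 : Tendsto u atTop (𝓝 1) := by
    have h : Tendsto (fun k : ℕ => (1 : ℝ) / ((k : ℝ) + 2)) atTop (𝓝 0) :=
      tendsto_const_nhds.div_atTop (tendsto_atTop_add_const_right _ _ tendsto_natCast_atTop_atTop)
    simpa [u] using h.const_sub 1
  have hg : Antitone g := fun j k hjk => by
    refine sdiff_subset_sdiff_right (iUnion₂_mono fun q hq => ?_)
    exact Metric.closedBall_subset_closedBall (mul_le_mul_of_nonneg_right (hu hjk) (hP q hq).le)
  have hgm : ∀ k, NullMeasurableSet (g k) volume := fun k =>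
    (measurableSet_ball.diff
      (P.measurableSet_biUnion fun x _ => measurableSet_closedBall)).nullMeasurableSet
  have htend := tendsto_measure_iInter_atTop (μ := volume) hgm hg
    ⟨0, ne_top_of_le_ne_top measure_ball_lt_top.ne (measure_mono sdiff_subset)⟩
  have hlt : volume (⋂ k, g k) < ε := by
    refine lt_of_le_of_lt ?_ hv
    have hsub : ⋂ k, g k ⊆ (Metric.ball 0 r \ ⋃ q ∈ P, Metric.closedBall q.1 q.2) ∪
        ⋃ q ∈ P, Metric.sphere q.1 q.2 := by
      intro w hw
      rw [mem_iInter] at hw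
      by_cases h : w ∈ ⋃ q ∈ P, Metric.closedBall q.1 q.2
      · obtain ⟨q, hq, hwq⟩ := mem_iUnion₂.1 h
        refine Or.inr (mem_iUnion₂.2 ⟨q, hq, le_antisymm hwq ?_⟩)
        have hlim : Tendsto (fun k => u k * q.2) atTop (𝓝 q.2) := by
          simpa using hu1.mul_const q.2
        refine le_of_tendsto' hlim fun k => le_of_not_ge fun hk => ?_
        exact (hw k).2 (mem_iUnion₂.2 ⟨q, hq, hk⟩)
      · exact Or.inl ⟨(hw 0).1, h⟩
    refine (measure_mono hsub).trans ((measure_union_le _ _).trans ?_)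
    have : volume (⋃ q ∈ P, Metric.sphere q.1 q.2) = 0 := by
      refine (measure_biUnion_null_iff P.countable_toSet).2 fun q hq => ?_
      exact Measure.addHaar_sphere_of_ne_zero _ _ (hP q hq).ne'
    rw [this, add_zero]
  obtain ⟨k, hk1, hk2⟩ := ((htend.eventually (gt_mem_nhds hlt)).and
    (hu1.eventually (lt_mem_nhds (show 1 - η < 1 by linarith)))).exists
  refine ⟨u k, ?_, ?_, by linarith, hk1⟩
  · have : 1 / ((k : ℝ) + 2) < 1 := (div_lt_one (by positivity)).2 (by linarith [k.cast_nonneg (α := ℝ)])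
    simp only [u]
    linarith
  · have : 0 < 1 / ((k : ℝ) + 2) := by positivity
    simp only [u]
    linarith

/-! ### Descent to the circle and forms that are locally pull-backs of radial forms -/

/-- A form on `ℝ²ᵐ × ℝ/ℤ` whose lift is `F`, when `F` is 1-periodic. -/
def descend (F : Eucl m × ℝ → (Eucl m × ℝ →L[ℝ] ℝ)) : OneForm m :=
  fun x => F (x.1, Quotient.out x.2)

theorem lift_descend {F : Eucl m × ℝ → (Eucl m × ℝ →L[ℝ] ℝ)}
    (hF : ∀ z s, F (z, s + 1) = F (z, s)) : (descend F).lift = F := by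
  ext1 ⟨z, s⟩
  have hper : Function.Periodic (fun s => F (z, s)) 1 := fun s => hF z s
  have h : ((Quotient.out (s : UnitAddCircle) : ℝ) : UnitAddCircle) = s := Quotient.out_eq _
  obtain ⟨k, hk⟩ := AddSubgroup.mem_zmultiples_iff.1 (QuotientAddGroup.eq.1 h.symm)
  have hk' : (Quotient.out (s : UnitAddCircle) : ℝ) = s + k • (1 : ℝ) := by
    linarith
  show F (z, Quotient.out (s : UnitAddCircle)) = F (z, s)
  rw [hk']
  exact hper.zsmul k s

theorem surjective_of_det_ne_zero {V : Type*} [AddCommGroup V] [Module ℝ V]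
    [FiniteDimensional ℝ V] {L : V →ₗ[ℝ] V} (h : LinearMap.det L ≠ 0) :
    Function.Surjective L :=
  (LinearMap.equivOfDetNeZero L h).surjective

section LocalModel

variable {r : ℝ} {lam : Eucl m → (Eucl m →L[ℝ] ℝ)} {f : Eucl m → ℝ}
  {F : Eucl m × ℝ → (Eucl m × ℝ →L[ℝ] ℝ)} {p : Eucl m × ℝ} {τ b h' : ℝ} {c : Eucl m} {h : ℝ → ℝ}

theorem dOne_of_eventuallyEq_pullback (hfs : ContDiffOn ℝ ∞ f (Metric.ball 0 r))
    (hf : ∀ z ∈ Metric.ball (0 : Eucl m) r, HasFDerivAt f (lam z - liouville m z) z)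
    (hp : p ∈ coverTorus m r)
    (hF : ∀ᶠ q in 𝓝 p, F q = (radialForm h (tubeMap τ c b f q)).comp (dTubeMap τ c b lam f q))
    (hd : HasDerivAt h h' (‖spin τ f p - c‖ ^ 2)) :
    dOne F p = (dOne (radialForm h) (tubeMap τ c b f p)).compContinuousLinearMap
      (dTubeMap τ c b lam f p) := by
  have hopen := (isOpen_coverTorus m r).mem_nhds hp
  have hF' : F =ᶠ[𝓝 p] fun q => (radialForm h (tubeMap τ c b f q)).comp
      (fderiv ℝ (tubeMap τ c b f) q) := by
    filter_upwards [hF, hopen] with q hq hq'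
    rw [hq, (hasFDerivAt_tubeMap τ c b (hf q.1 hq'.1)).fderiv]
  obtain ⟨D, hD, -⟩ := hasFDerivAt_radialForm (tubeMap τ c b f p) hd
  rw [dOne_congr hF', dOne_pullback hD.differentiableAt
    ((contDiffOn_tubeMap τ c b hfs).contDiffAt hopen),
    (hasFDerivAt_tubeMap τ c b (hf p.1 hp.1)).fderiv]

theorem abs_contactDensity_of_eventuallyEq_pullback (hfs : ContDiffOn ℝ ∞ f (Metric.ball 0 r))
    (hf : ∀ z ∈ Metric.ball (0 : Eucl m) r, HasFDerivAt f (lam z - liouville m z) z)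
    (hp : p ∈ coverTorus m r)
    (hF : ∀ᶠ q in 𝓝 p, F q = (radialForm h (tubeMap τ c b f q)).comp (dTubeMap τ c b lam f q))
    (hd : HasDerivAt h h' (‖spin τ f p - c‖ ^ 2)) :
    |contactDensity F p| = |b| * |1 - h (‖spin τ f p - c‖ ^ 2) + ‖spin τ f p - c‖ ^ 2 * h'| *
      stdCoeff m := by
  rw [contactDensity_eq_topCoeff, dOne_of_eventuallyEq_pullback hfs hf hp hF hd, hF.self_of_nhds,
    topCoeff_pullback, topCoeff_radialForm (tubeMap τ c b f p) hd, abs_mul, abs_det_dTubeMap,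
    abs_mul, abs_of_pos (stdCoeff_pos m), mul_assoc]
  rfl

/-- The differential of `tubeMap` is invertible as `b ≠ 0`, so it carries the Reeb vector to the
Reeb vector of the radial form. -/
theorem reeb_of_eventuallyEq_pullback (hfs : ContDiffOn ℝ ∞ f (Metric.ball 0 r))
    (hf : ∀ z ∈ Metric.ball (0 : Eucl m) r, HasFDerivAt f (lam z - liouville m z) z)
    (hp : p ∈ coverTorus m r) (hb : b ≠ 0)
    (hF : ∀ᶠ q in 𝓝 p, F q = (radialForm h (tubeMap τ c b f q)).comp (dTubeMap τ c b lam f q))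
    (hd : HasDerivAt h h' (‖spin τ f p - c‖ ^ 2)) {v : Eucl m × ℝ} (hv : F p v = 1)
    (hker : ∀ u, dOne F p ![v, u] = 0) :
    inner ℝ (spin τ f p - c) (dSpin τ lam f p v) = 0 ∧ dAngle τ c b lam f p v *
      (1 - h (‖spin τ f p - c‖ ^ 2) + ‖spin τ f p - c‖ ^ 2 * h') = 1 := by
  have hdet : LinearMap.det (dTubeMap τ c b lam f p : Eucl m × ℝ →ₗ[ℝ] Eucl m × ℝ) ≠ 0 := by
    rw [← abs_pos, abs_det_dTubeMap, abs_pos]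
    exact hb
  refine reeb_radialForm (tubeMap τ c b f p) (dTubeMap τ c b lam f p v) hd ?_ fun u => ?_
  · rw [hF.self_of_nhds] at hv
    exact hv
  · obtain ⟨w, rfl⟩ := surjective_of_det_ne_zero hdet u
    rw [← hker w, dOne_of_eventuallyEq_pullback hfs hf hp hF hd,
      ContinuousAlternatingMap.compContinuousLinearMap_apply]
    congr 1
    ext k <;> fin_cases k <;> rfl

end LocalModel

/-! ### The perturbed contact form -/

/-- The data of a plug: a packing of the ball of radius `r₁` by tubes, the radius `r₂` beyond which
nothing is changed, the parameter `θ` of the profiles, and a potential `f` of `lam - λ₀`. -/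
structure Plug (m : ℕ) (r : ℝ) (lam : Eucl m → (Eucl m →L[ℝ] ℝ)) where
  n : ℕ
  r₁ : ℝ
  r₂ : ℝ
  θ : ℝ
  P : Finset (Eucl m × ℝ)
  f : Eucl m → ℝ
  n_pos : 0 < n
  r₁_pos : 0 < r₁
  r₁_lt : r₁ < r₂
  r₂_lt : r₂ < r
  θ_pos : 0 < θ
  θ_lt : θ < 1
  packing : IsPacking n r₁ P
  lam_smooth : ContDiffOn ℝ ∞ lam (Metric.ball 0 r)
  f_smooth : ContDiffOn ℝ ∞ f (Metric.ball 0 r)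
  f_deriv : ∀ z ∈ Metric.ball (0 : Eucl m) r, HasFDerivAt f (lam z - liouville m z) z

namespace Plug

variable {r : ℝ} {lam : Eucl m → (Eucl m →L[ℝ] ℝ)} (D : Plug m r lam)

/-- The rotation angle of the first return map. -/
def τ : ℝ := 2 * Real.pi / D.n

/-- The Hamiltonian of the rotation. -/
def outer (ρ : ℝ) : ℝ := D.τ / 2 * profile (D.r₁ ^ 2) (D.r₂ ^ 2) ρ

/-- The period of the tubes divided by `n`. -/
def b : ℝ := 1 + D.outer 0

/-- The slope of the Hamiltonian in a ball of radius `R`. -/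
def slope (R : ℝ) : ℝ := (1 - 1 / D.n) / (D.θ * R ^ 2)

/-- The Hamiltonian in a ball of radius `R`. -/
def bump (R ρ : ℝ) : ℝ := D.slope R * profile (D.θ ^ 2 * R ^ 2) (D.θ * R ^ 2) ρ

/-- The form on the universal cover, with amplitudes `x` for the tubes and `y` for the rotation. -/
def form (x y : ℝ) (p : Eucl m × ℝ) : Eucl m × ℝ →L[ℝ] ℝ :=
  addDs lam (toTorus p) + (y * D.outer (‖p.1‖ ^ 2)) • dHeight lam p -
    x • ∑ q ∈ D.P, D.bump q.2 (‖spin D.τ D.f p - q.1‖ ^ 2) • dAngle D.τ q.1 D.b lam D.f p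

theorem τ_pos : 0 < D.τ := by
  have := D.n_pos
  have := Real.pi_pos
  unfold τ
  positivity

theorem sq_lt : D.r₁ ^ 2 < D.r₂ ^ 2 := by
  have := D.r₁_pos
  have := D.r₁_lt
  gcongr

theorem outer_nonneg (ρ : ℝ) : 0 ≤ D.outer ρ :=
  mul_nonneg (by linarith [D.τ_pos]) (profile_nonneg D.sq_lt)

theorem one_le_b : 1 ≤ D.b := by
  linarith [D.outer_nonneg 0, show D.b = 1 + D.outer 0 from rfl]

theorem one_div_n_le_one : (1 : ℝ) / D.n ≤ 1 := by
  have : (1 : ℝ) ≤ D.n := by exact_mod_cast D.n_pos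
  exact (div_le_one (by linarith)).2 this

theorem slope_nonneg (R : ℝ) : 0 ≤ D.slope R :=
  div_nonneg (by linarith [D.one_div_n_le_one]) (mul_nonneg D.θ_pos.le (sq_nonneg R))

/-- The profile of a bump is affine up to distance `θR` from the centre and vanishes from distance
`√θ R < R` on. The balls of radius `θR` get small density, and nothing changes near the boundary of
the tube. -/
theorem profile_lt {R : ℝ} (hR : 0 < R) : D.θ ^ 2 * R ^ 2 < D.θ * R ^ 2 := by
  have := D.θ_pos
  have := D.θ_lt
  have h : D.θ ^ 2 < D.θ := by nlinarith
  gcongr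

theorem bump_of_ge {R ρ : ℝ} (hR : 0 < R) (h : D.θ * R ^ 2 ≤ ρ) : D.bump R ρ = 0 := by
  rw [bump, profile_of_ge (D.profile_lt hR) h, mul_zero]

/-- The term `-(τ/2)ρ` cancels the one produced by the rotating frame, leaving the constant
coefficient `b`. -/
theorem outer_of_le {ρ : ℝ} (h : ρ ≤ D.r₁ ^ 2) : D.outer ρ = D.b - 1 - D.τ / 2 * ρ := by
  rw [b, outer, outer, profile_sub_profile D.sq_lt (sq_nonneg _) h]
  ring

theorem outer_of_ge {ρ : ℝ} (h : D.r₂ ^ 2 ≤ ρ) : D.outer ρ = 0 := by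
  rw [outer, profile_of_ge D.sq_lt h, mul_zero]

theorem contDiff_outer : ContDiff ℝ ∞ D.outer := contDiff_const.mul contDiff_profile

theorem contDiff_bump (R : ℝ) : ContDiff ℝ ∞ (D.bump R) := contDiff_const.mul contDiff_profile

theorem hasDerivAt_outer (ρ : ℝ) :
    HasDerivAt D.outer (-(D.τ / 2 * cutoff (D.r₁ ^ 2) (D.r₂ ^ 2) ρ)) ρ := by
  rw [← mul_neg]
  exact hasDerivAt_profile.const_mul _

theorem hasDerivAt_bump (R ρ : ℝ) : HasDerivAt (D.bump R)
    (-(D.slope R * cutoff (D.θ ^ 2 * R ^ 2) (D.θ * R ^ 2) ρ)) ρ := by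
  rw [← mul_neg]
  exact hasDerivAt_profile.const_mul _

theorem norm_spin (τ : ℝ) (f : Eucl m → ℝ) (p : Eucl m × ℝ) : ‖spin τ f p‖ = ‖p.1‖ :=
  norm_rot _ _

theorem rot_injective : Function.Injective fun q : Eucl m × ℝ => (rot m D.τ q.1, q.2) :=
  fun _ _ h => Prod.ext ((rotIso m D.τ).injective (Prod.ext_iff.1 h).1) (Prod.ext_iff.1 h).2

theorem image_rot [DecidableEq (Eucl m × ℝ)] :
    D.P.image (fun q => (rot m D.τ q.1, q.2)) = D.P :=
  Finset.eq_of_subset_of_card_le (Finset.image_subset_iff.2 D.packing.rot_mem)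
    (Finset.card_image_of_injective _ D.rot_injective).ge

theorem sum_rot {M : Type*} [AddCommMonoid M] (F : Eucl m × ℝ → M) :
    ∑ q ∈ D.P, F (rot m D.τ q.1, q.2) = ∑ q ∈ D.P, F q := by
  classical
  conv_rhs => rw [← D.image_rot, Finset.sum_image D.rot_injective.injOn]

theorem spin_add_one (τ : ℝ) (f : Eucl m → ℝ) (z : Eucl m) (s : ℝ) :
    spin τ f (z, s + 1) = rot m (-τ) (spin τ f (z, s)) := by
  simp only [spin, height]
  rw [← rot_add]
  ring_nf

theorem linForm_rot_neg (τ : ℝ) (c u : Eucl m) :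
    linForm c (rot m (-τ) u) = linForm (rot m τ c) u := by
  simp only [linForm, liouville_apply]
  rw [cplx_rot, ← inner_rot_rot (-τ) (rot m τ _), rot_neg_rot]

theorem dAngle_add_one (τ : ℝ) (c : Eucl m) (b : ℝ) (lam : Eucl m → (Eucl m →L[ℝ] ℝ))
    (f : Eucl m → ℝ) (z : Eucl m) (s : ℝ) :
    dAngle τ c b lam f (z, s + 1) = dAngle τ (rot m τ c) b lam f (z, s) := by
  refine ContinuousLinearMap.ext fun v => ?_
  have h1 : dHeight lam (z, s + 1) = dHeight lam (z, s) := rfl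
  have h2 : dSpin τ lam f (z, s + 1) v = rot m (-τ) (dSpin τ lam f (z, s) v) := by
    rw [dSpin_apply, dSpin_apply, h1, ← rot_add]
    simp only [height]
    ring_nf
  simp only [dAngle, _root_.add_apply, ContinuousLinearMap.comp_apply, h1, h2, linForm_rot_neg]

/-- Going once around the circle turns the rotating frame by `-τ`, which amounts to replacing each
centre `c` by `rot m τ c`; the packing is invariant under this, so the sum is only reindexed. -/
theorem form_add_one (x y : ℝ) (z : Eucl m) (s : ℝ) : D.form x y (z, s + 1) = D.form x y (z, s) := by
  have h0 : (toTorus (z, s + 1) : Eucl m × UnitAddCircle) = toTorus (z, s) := by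
    simp only [toTorus]
    rw [AddCircle.coe_add_period]
  have hnorm : ∀ q : Eucl m × ℝ, ‖spin D.τ D.f (z, s + 1) - q.1‖ =
      ‖spin D.τ D.f (z, s) - rot m D.τ q.1‖ := fun q => by
    rw [spin_add_one, ← norm_rot D.τ (_ - q.1), map_sub, rot_rot_neg]
  unfold form
  rw [← D.sum_rot fun q => D.bump q.2 (‖spin D.τ D.f (z, s) - q.1‖ ^ 2) •
    dAngle D.τ q.1 D.b lam D.f (z, s), h0]
  congr 2
  refine Finset.sum_congr rfl fun q _ => ?_
  rw [hnorm, dAngle_add_one]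

theorem lift_form (x y : ℝ) : (descend (D.form x y)).lift = D.form x y :=
  lift_descend fun z s => D.form_add_one x y z s

/-- The other bumps vanish by disjointness, and the tube lies where `outer` is affine. The amplitude
of the rotation has to be exactly `1` for its coefficient to be the one in
`radialForm_comp_dTubeMap`. -/
theorem form_of_tube (x : ℝ) {p q : Eucl m × ℝ} (hq : q ∈ D.P)
    (hpq : ‖spin D.τ D.f p - q.1‖ < q.2) :
    D.form x 1 p = (radialForm (fun ρ => x * D.bump q.2 ρ) (tubeMap D.τ q.1 D.b D.f p)).comp
      (dTubeMap D.τ q.1 D.b lam D.f p) := by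
  have hmem : spin D.τ D.f p ∈ Metric.closedBall q.1 q.2 := by
    rw [mem_closedBall_iff_norm]
    exact hpq.le
  have hnorm : ‖p.1‖ < D.r₁ := by
    have := D.packing.subset q hq hmem
    rwa [mem_ball_zero_iff, norm_spin] at this
  rw [radialForm_comp_dTubeMap, form, one_mul, D.outer_of_le (by gcongr),
    Finset.sum_eq_single_of_mem q hq, smul_smul]
  intro q' hq' hne
  rw [D.bump_of_ge (D.packing.pos q' hq'), zero_smul]
  have h1 : q'.2 < ‖spin D.τ D.f p - q'.1‖ := by
    by_contra! h
    exact Set.disjoint_left.1 (D.packing.disjoint hq' hq hne) (mem_closedBall_iff_norm.2 h) hmem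
  have h2 := D.packing.pos q' hq'
  have h3 : q'.2 ^ 2 ≤ ‖spin D.τ D.f p - q'.1‖ ^ 2 := by gcongr
  have := D.θ_lt
  nlinarith [sq_nonneg q'.2]

/-- Without bumps the form is `λ₀ + (1 + y outer(|z|²)) dh`, radial in the coordinates `(z, h)`;
these are the tube coordinates with speed `0`, centre `0` and `b = 1`. -/
theorem form_of_outside {x : ℝ} (y : ℝ) {p : Eucl m × ℝ}
    (hp : x = 0 ∨ ∀ q ∈ D.P, D.θ * q.2 ^ 2 ≤ ‖spin D.τ D.f p - q.1‖ ^ 2) :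
    D.form x y p = (radialForm (fun ρ => -(y * D.outer ρ)) (tubeMap 0 0 1 D.f p)).comp
      (dTubeMap 0 0 1 lam D.f p) := by
  have h1 : spin 0 D.f p - 0 = p.1 := by simp [spin]
  have h2 : dAngle 0 0 1 lam D.f p = dHeight lam p := by simp [dAngle, linForm]
  have h3 : x • ∑ q ∈ D.P, D.bump q.2 (‖spin D.τ D.f p - q.1‖ ^ 2) •
      dAngle D.τ q.1 D.b lam D.f p = 0 := by
    rcases hp with rfl | hp
    · exact zero_smul _ _
    · rw [Finset.sum_eq_zero fun q hq => ?_, smul_zero]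
      rw [D.bump_of_ge (D.packing.pos q hq) (hp q hq), zero_smul]
  rw [radialForm_comp_dTubeMap, h1, h2, form, h3]
  module

theorem continuousAt_spin {p : Eucl m × ℝ} (hp : p ∈ coverTorus m r) :
    ContinuousAt (spin D.τ D.f) p :=
  ((contDiffOn_spin D.τ D.f_smooth).contDiffAt
    ((isOpen_coverTorus m r).mem_nhds hp)).continuousAt

theorem eventually_form_of_tube (x : ℝ) {p q : Eucl m × ℝ} (hp : p ∈ coverTorus m r)
    (hq : q ∈ D.P) (hpq : ‖spin D.τ D.f p - q.1‖ < q.2) :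
    ∀ᶠ p' in 𝓝 p, D.form x 1 p' = (radialForm (fun ρ => x * D.bump q.2 ρ)
      (tubeMap D.τ q.1 D.b D.f p')).comp (dTubeMap D.τ q.1 D.b lam D.f p') := by
  have h := ((D.continuousAt_spin hp).sub continuousAt_const).norm.eventually (gt_mem_nhds hpq)
  filter_upwards [h] with p' hp'
  exact D.form_of_tube x hq hp'

/-- The bumps are supported strictly inside the tubes, so the formula persists near a point on the
boundary of a tube. Together with the open tubes, this covers every point by a local model. -/
theorem eventually_form_of_outside {x : ℝ} (y : ℝ) {p : Eucl m × ℝ} (hp : p ∈ coverTorus m r)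
    (h : x = 0 ∨ ∀ q ∈ D.P, q.2 ≤ ‖spin D.τ D.f p - q.1‖) :
    ∀ᶠ p' in 𝓝 p, D.form x y p' = (radialForm (fun ρ => -(y * D.outer ρ))
      (tubeMap 0 0 1 D.f p')).comp (dTubeMap 0 0 1 lam D.f p') := by
  rcases h with rfl | h
  · exact Eventually.of_forall fun p' => D.form_of_outside y (Or.inl rfl)
  · have h1 : ∀ q ∈ D.P, ∀ᶠ p' in 𝓝 p, D.θ * q.2 ^ 2 < ‖spin D.τ D.f p' - q.1‖ ^ 2 := by
      intro q hq
      refine (((D.continuousAt_spin hp).sub continuousAt_const).norm.pow 2).eventually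
        (lt_mem_nhds ?_)
      have h2 := D.packing.pos q hq
      have h3 : q.2 ^ 2 ≤ ‖spin D.τ D.f p - q.1‖ ^ 2 := by
        have := h q hq
        gcongr
      have := D.θ_lt
      have : 0 < q.2 ^ 2 := by positivity
      show D.θ * q.2 ^ 2 < ‖spin D.τ D.f p - q.1‖ ^ 2
      nlinarith
    filter_upwards [(Finset.eventually_all D.P).2 h1] with p' hp'
    exact D.form_of_outside y (Or.inr fun q hq => (hp' q hq).le)

/-! ### Density factors, the contact condition and the isotopy -/

/-- The density factor in a tube of radius `R`. -/
def tubeFactor (x R ρ : ℝ) : ℝ :=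
  1 - x * (D.slope R * (profile (D.θ ^ 2 * R ^ 2) (D.θ * R ^ 2) ρ +
    ρ * cutoff (D.θ ^ 2 * R ^ 2) (D.θ * R ^ 2) ρ))

/-- The density factor outside the tubes. -/
def outerFactor (y ρ : ℝ) : ℝ :=
  1 + y * (D.τ / 2 * (profile (D.r₁ ^ 2) (D.r₂ ^ 2) ρ + ρ * cutoff (D.r₁ ^ 2) (D.r₂ ^ 2) ρ))

theorem hasDerivAt_mul_bump (x R ρ : ℝ) : HasDerivAt (fun ρ => x * D.bump R ρ)
    (x * (-(D.slope R * cutoff (D.θ ^ 2 * R ^ 2) (D.θ * R ^ 2) ρ))) ρ :=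
  (D.hasDerivAt_bump R ρ).const_mul x

theorem hasDerivAt_mul_outer (y ρ : ℝ) : HasDerivAt (fun ρ => -(y * D.outer ρ))
    (-(y * (-(D.τ / 2 * cutoff (D.r₁ ^ 2) (D.r₂ ^ 2) ρ)))) ρ :=
  ((D.hasDerivAt_outer ρ).const_mul y).neg

/-- The slope is normalised so that its product with `θR²`, the largest possible value of the
bracket, is `1 - 1/n`. -/
theorem one_div_le_tubeFactor {x R ρ : ℝ} (hx : x ∈ Icc (0 : ℝ) 1) (hR : 0 < R) (hρ : 0 ≤ ρ) :
    1 / (D.n : ℝ) ≤ D.tubeFactor x R ρ := by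
  have hB : 0 < D.θ * R ^ 2 := mul_pos D.θ_pos (by positivity)
  have h1 := profile_add_mul_le hB.le (D.profile_lt hR) hρ
  have h2 : D.slope R * (profile (D.θ ^ 2 * R ^ 2) (D.θ * R ^ 2) ρ +
      ρ * cutoff (D.θ ^ 2 * R ^ 2) (D.θ * R ^ 2) ρ) ≤ 1 - 1 / D.n := by
    refine (mul_le_mul_of_nonneg_left h1 (D.slope_nonneg R)).trans_eq ?_
    rw [slope, div_mul_cancel₀ _ hB.ne']
  have h3 := D.one_div_n_le_one
  have h4 : 0 ≤ D.slope R * (profile (D.θ ^ 2 * R ^ 2) (D.θ * R ^ 2) ρ +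
      ρ * cutoff (D.θ ^ 2 * R ^ 2) (D.θ * R ^ 2) ρ) :=
    mul_nonneg (D.slope_nonneg R) (profile_add_mul_nonneg (D.profile_lt hR) hρ)
  have h5 := mul_le_of_le_one_left h4 hx.2
  unfold tubeFactor
  linarith

theorem tubeFactor_le_one {x R ρ : ℝ} (hx : 0 ≤ x) (hR : 0 < R) (hρ : 0 ≤ ρ) :
    D.tubeFactor x R ρ ≤ 1 := by
  have := mul_nonneg hx (mul_nonneg (D.slope_nonneg R)
    (profile_add_mul_nonneg (D.profile_lt hR) hρ))
  unfold tubeFactor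
  linarith

theorem tubeFactor_le {R ρ : ℝ} (hR : 0 < R) (h : ρ ≤ D.θ ^ 2 * R ^ 2) :
    D.tubeFactor 1 R ρ ≤ 1 / D.n + (1 - D.θ) := by
  have h1 := mul_le_mul_of_nonneg_left (le_profile_add_mul (D.profile_lt hR) h) (D.slope_nonneg R)
  have h2 : D.slope R * (D.θ ^ 2 * R ^ 2) = (1 - 1 / D.n) * D.θ := by
    have := D.θ_pos.ne'
    rw [slope]
    field_simp
  have h3 : (1 : ℝ) / D.n * (1 - D.θ) ≥ 0 :=
    mul_nonneg (by positivity) (by linarith [D.θ_lt])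
  unfold tubeFactor
  nlinarith [D.θ_lt]

theorem one_le_outerFactor {y ρ : ℝ} (hy : 0 ≤ y) (hρ : 0 ≤ ρ) : 1 ≤ D.outerFactor y ρ := by
  have := mul_nonneg hy (mul_nonneg (by linarith [D.τ_pos] : 0 ≤ D.τ / 2)
    (profile_add_mul_nonneg D.sq_lt hρ))
  unfold outerFactor
  linarith

theorem outerFactor_le {ρ : ℝ} (hρ : 0 ≤ ρ) : D.outerFactor 1 ρ ≤ 1 + D.τ / 2 * D.r₂ ^ 2 := by
  have := mul_le_mul_of_nonneg_left (profile_add_mul_le (sq_nonneg D.r₂) D.sq_lt hρ)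
    (by linarith [D.τ_pos] : 0 ≤ D.τ / 2)
  unfold outerFactor
  linarith

theorem b_le : D.b ≤ 1 + D.τ / 2 * D.r₂ ^ 2 := by
  have h : D.b = D.outerFactor 1 0 := by
    rw [b, outer, outerFactor]
    ring
  rw [h]
  exact D.outerFactor_le le_rfl

theorem abs_contactDensity_of_tube {x : ℝ} (hx : x ∈ Icc (0 : ℝ) 1) {p q : Eucl m × ℝ}
    (hp : p ∈ coverTorus m r) (hq : q ∈ D.P) (hpq : ‖spin D.τ D.f p - q.1‖ < q.2) :
    |contactDensity (D.form x 1) p| =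
      D.b * D.tubeFactor x q.2 (‖spin D.τ D.f p - q.1‖ ^ 2) * stdCoeff m := by
  have h := D.one_div_le_tubeFactor hx (D.packing.pos q hq)
    (sq_nonneg ‖spin D.τ D.f p - q.1‖)
  have h' : (0 : ℝ) ≤ 1 / D.n := by positivity
  rw [abs_contactDensity_of_eventuallyEq_pullback D.f_smooth D.f_deriv hp
    (D.eventually_form_of_tube x hp hq hpq) (D.hasDerivAt_mul_bump x q.2 _),
    abs_of_pos (by linarith [D.one_le_b] : 0 < D.b), ← abs_of_nonneg (h'.trans h)]
  congr 3
  simp only [tubeFactor, bump]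
  ring

theorem abs_contactDensity_of_outside {x y : ℝ} (hy : 0 ≤ y) {p : Eucl m × ℝ}
    (hp : p ∈ coverTorus m r) (h : x = 0 ∨ ∀ q ∈ D.P, q.2 ≤ ‖spin D.τ D.f p - q.1‖) :
    |contactDensity (D.form x y) p| = D.outerFactor y (‖p.1‖ ^ 2) * stdCoeff m := by
  have h1 := D.one_le_outerFactor hy (sq_nonneg ‖p.1‖)
  have h2 : spin 0 D.f p - 0 = p.1 := by simp [spin]
  rw [abs_contactDensity_of_eventuallyEq_pullback D.f_smooth D.f_deriv hp
    (D.eventually_form_of_outside y hp h) (D.hasDerivAt_mul_outer y _),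
    ← abs_of_pos (by linarith : 0 < D.outerFactor y (‖p.1‖ ^ 2)), abs_one, one_mul, h2]
  congr 2
  simp only [outerFactor, outer]
  ring

theorem contDiffOn_form {x y : ℝ → ℝ} (hx : ContDiff ℝ ∞ x) (hy : ContDiff ℝ ∞ y) :
    ContDiffOn ℝ ∞ (fun q : ℝ × (Eucl m × ℝ) => D.form (x q.1) (y q.1) q.2)
      (univ ×ˢ coverTorus m r) := by
  have hsnd : ∀ {G : Type _} [NormedAddCommGroup G] [NormedSpace ℝ G] {g : Eucl m × ℝ → G},
      ContDiffOn ℝ ∞ g (coverTorus m r) →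
      ContDiffOn ℝ ∞ (fun q : ℝ × (Eucl m × ℝ) => g q.2) (univ ×ˢ coverTorus m r) :=
    fun hg => hg.comp contDiff_snd.contDiffOn fun _ hq => hq.2
  have hfst : ∀ {g : ℝ → ℝ}, ContDiff ℝ ∞ g →
      ContDiffOn ℝ ∞ (fun q : ℝ × (Eucl m × ℝ) => g q.1) (univ ×ˢ coverTorus m r) :=
    fun hg => (hg.comp contDiff_fst).contDiffOn
  have h1 : ContDiffOn ℝ ∞ (fun p : Eucl m × ℝ => addDs lam (toTorus p)) (coverTorus m r) :=
    ((contDiffOn_comp_fst D.lam_smooth).clm_comp contDiffOn_const).add contDiffOn_const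
  have h2 : ContDiffOn ℝ ∞ (fun p : Eucl m × ℝ => D.outer (‖p.1‖ ^ 2)) (coverTorus m r) :=
    (D.contDiff_outer.comp ((contDiff_norm_sq ℝ).comp contDiff_fst)).contDiffOn
  have h3 : ∀ q : Eucl m × ℝ, ContDiffOn ℝ ∞
      (fun p : Eucl m × ℝ => D.bump q.2 (‖spin D.τ D.f p - q.1‖ ^ 2)) (coverTorus m r) := fun q =>
    (D.contDiff_bump q.2).comp_contDiffOn ((contDiff_norm_sq ℝ).comp_contDiffOn
      ((contDiffOn_spin D.τ D.f_smooth).sub contDiffOn_const))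
  have h4 : ContDiffOn ℝ ∞ (fun p => ∑ q ∈ D.P, D.bump q.2 (‖spin D.τ D.f p - q.1‖ ^ 2) •
      dAngle D.τ q.1 D.b lam D.f p) (coverTorus m r) :=
    ContDiffOn.sum fun q _ => (h3 q).smul (contDiffOn_dAngle D.τ q.1 D.b D.lam_smooth D.f_smooth)
  exact ((hsnd h1).add (((hfst hy).mul (hsnd h2)).smul (hsnd (contDiffOn_dHeight D.lam_smooth)))).sub
    ((hfst hx).smul (hsnd h4))

/-- The density factor is at least `1/n` in the tubes and at least `1` elsewhere. The bumps may be
present only while the rotation has full amplitude. -/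
theorem isContactForm {x y : ℝ} (hx : x ∈ Icc (0 : ℝ) 1) (hy : 0 ≤ y) (hxy : x = 0 ∨ y = 1) :
    IsContactForm m r (descend (D.form x y)) := by
  rw [IsContactForm, lift_form]
  refine ⟨?_, fun p hp => ?_⟩
  · exact (D.contDiffOn_form (contDiff_const (c := x)) (contDiff_const (c := y))).comp
      (f := fun p : Eucl m × ℝ => ((0 : ℝ), p)) (by fun_prop) fun p hp => ⟨mem_univ _, hp⟩
  · rw [← abs_pos]
    by_cases h : x = 0 ∨ ∀ q ∈ D.P, q.2 ≤ ‖spin D.τ D.f p - q.1‖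
    · rw [D.abs_contactDensity_of_outside hy hp h]
      exact mul_pos (one_pos.trans_le (D.one_le_outerFactor hy (sq_nonneg _))) (stdCoeff_pos m)
    · push Not at h
      obtain ⟨hx0, q, hq, hpq⟩ := h
      obtain rfl := hxy.resolve_left hx0
      have hn : (0 : ℝ) < D.n := by exact_mod_cast D.n_pos
      rw [D.abs_contactDensity_of_tube hx hp hq hpq]
      exact mul_pos (mul_pos (by linarith [D.one_le_b]) ((by positivity : (0 : ℝ) < 1 / D.n).trans_le
        (D.one_div_le_tubeFactor hx (D.packing.pos q hq) (sq_nonneg _)))) (stdCoeff_pos m)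

theorem form_zero_zero : D.form 0 0 = (addDs lam).lift := by
  ext1 p
  simp [form, OneForm.lift]

/-- `spin` preserves the norm, so such a point lies outside all tubes, and `outer` vanishes from `r₂
^ 2` on. -/
theorem form_of_norm_gt (x y : ℝ) {p : Eucl m × ℝ} (hp : D.r₂ < ‖p.1‖) :
    D.form x y p = addDs lam (toTorus p) := by
  have hr : 0 < D.r₂ := D.r₁_pos.trans D.r₁_lt
  have h : ∀ q ∈ D.P, D.bump q.2 (‖spin D.τ D.f p - q.1‖ ^ 2) = 0 := by
    intro q hq
    have hq2 := D.packing.pos q hq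
    refine D.bump_of_ge hq2 ?_
    have h1 : q.2 < ‖spin D.τ D.f p - q.1‖ := by
      by_contra! h
      have h2 := D.packing.subset q hq (mem_closedBall_iff_norm.2 h)
      rw [mem_ball_zero_iff, norm_spin] at h2
      linarith [D.r₁_lt]
    have h3 : q.2 ^ 2 ≤ ‖spin D.τ D.f p - q.1‖ ^ 2 := by gcongr
    have := D.θ_lt
    nlinarith [sq_nonneg q.2]
  rw [form, D.outer_of_ge (by gcongr), Finset.sum_eq_zero fun q hq => by rw [h q hq, zero_smul]]
  simp

/-- The region near the boundary where nothing is changed. -/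
def collar : Set (Eucl m × UnitAddCircle) := {x | D.r₂ < ‖x.1‖}

theorem collar_mem : D.collar ∈ 𝓝ˢ (frontier (solidTorus m r)) := by
  have hr : r ≠ 0 := (D.r₁_pos.trans (D.r₁_lt.trans D.r₂_lt)).ne'
  refine (isOpen_lt continuous_const continuous_fst.norm).mem_nhdsSet.2 fun x hx => ?_
  rw [solidTorus, frontier_prod_univ_eq, frontier_ball _ hr] at hx
  have : ‖x.1‖ = r := by simpa using hx.1
  show D.r₂ < ‖x.1‖
  rw [this]
  exact D.r₂_lt

theorem descend_form_eqOn (x y : ℝ) (s : Set (Eucl m × UnitAddCircle)) :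
    EqOn (descend (D.form x y)) (addDs lam) (D.collar ∩ s) :=
  fun _ hx => D.form_of_norm_gt x y hx.1

theorem isotopic : IsotopicRelBoundary m r (descend (D.form 1 1)) (addDs lam) (addDs lam) := by
  -- The bumps are switched off during `[0, 1/2]`, the rotation during `[1/2, 1]`.
  let x : ℝ → ℝ := fun t => 1 - Real.smoothTransition (2 * t)
  let y : ℝ → ℝ := fun t => 1 - Real.smoothTransition (2 * t - 1)
  have hx : ContDiff ℝ ∞ x := contDiff_const.sub
    (Real.smoothTransition.contDiff.comp (contDiff_const.mul contDiff_id))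
  have hy : ContDiff ℝ ∞ y := contDiff_const.sub
    (Real.smoothTransition.contDiff.comp ((contDiff_const.mul contDiff_id).sub contDiff_const))
  refine ⟨fun t => descend (D.form (x t) (y t)), ?_, ?_, ?_, ?_, D.collar, D.collar_mem, ?_⟩
  · simp only [lift_form]
    exact (D.contDiffOn_form hx hy).mono (prod_mono_left (subset_univ _))
  · intro t _
    refine D.isContactForm ⟨?_, ?_⟩ ?_ ?_
    · linarith [Real.smoothTransition.le_one (2 * t)]
    · linarith [Real.smoothTransition.nonneg (2 * t)]
    · linarith [Real.smoothTransition.le_one (2 * t - 1)]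
    · rcases le_total t (1 / 2) with h | h
      · right
        simp only [y]
        rw [Real.smoothTransition.zero_of_nonpos (by linarith), sub_zero]
      · left
        simp only [x]
        rw [Real.smoothTransition.one_of_one_le (by linarith), sub_self]
  · intro p _
    have h1 : x 0 = 1 := by simp [x]
    have h2 : y 0 = 1 := by
      simp only [y]
      rw [Real.smoothTransition.zero_of_nonpos (by norm_num), sub_zero]
    simp only [h1, h2]
  · intro p _
    have h1 : x 1 = 0 := by
      simp only [x]
      rw [Real.smoothTransition.one_of_one_le (by norm_num), sub_self]
    have h2 : y 1 = 0 := by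
      simp only [y]
      rw [Real.smoothTransition.one_of_one_le (by norm_num), sub_self]
    simp only [h1, h2, descend, form_zero_zero]
    rfl
  · intro t _
    exact D.descend_form_eqOn _ _ _

end Plug

/-! ### Periods of closed Reeb orbits -/

theorem exists_int_of_toTorus_eq {p p' : Eucl m × ℝ} (h : toTorus p = toTorus p') :
    p.1 = p'.1 ∧ ∃ k : ℤ, p.2 = p'.2 + k := by
  have h1 : p.1 = p'.1 := (Prod.ext_iff.1 h).1
  have h2 : (p'.2 : UnitAddCircle) = p.2 := (Prod.ext_iff.1 h).2.symm
  obtain ⟨k, hk⟩ := AddSubgroup.mem_zmultiples_iff.1 (QuotientAddGroup.eq.1 h2)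
  refine ⟨h1, k, ?_⟩
  simp only [zsmul_eq_mul, mul_one] at hk
  linarith

theorem sub_le_of_hasDerivAt_le {g g' : ℝ → ℝ} (hg : ∀ t, HasDerivAt g (g' t) t) {C T : ℝ}
    (hC : ∀ t, g' t ≤ C) (hT : 0 ≤ T) : g T - g 0 ≤ C * T := by
  have h := (convex_univ (𝕜 := ℝ) (E := ℝ)).image_sub_le_mul_sub_of_deriv_le (f := g) (C := C)
    (fun t _ => (hg t).continuousAt.continuousWithinAt)
    (fun t _ => (hg t).differentiableAt.differentiableWithinAt)
    (fun t _ => by rw [(hg t).deriv]; exact hC t) 0 (mem_univ _) T (mem_univ _) hT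
  simpa using h

theorem lt_of_hasDerivAt_pos {g g' : ℝ → ℝ} (hg : ∀ t, HasDerivAt g (g' t) t) {T : ℝ}
    (hpos : ∀ t, 0 < g' t) (hT : 0 < T) : g 0 < g T :=
  strictMono_of_deriv_pos (fun t => by rw [(hg t).deriv]; exact hpos t) hT

/-- A function whose derivative vanishes wherever it takes values less than `C` is constant as soon
as it takes one value less than `C`. -/
theorem eq_of_hasDerivAt_zero_below {q q' : ℝ → ℝ} {C : ℝ} (hq : ∀ t, HasDerivAt q (q' t) t)
    (hq' : ∀ t, q t < C → q' t = 0) {t₀ : ℝ} (h₀ : q t₀ < C) (t : ℝ) : q t = q t₀ := by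
  have hcont : Continuous q := continuous_iff_continuousAt.2 fun t => (hq t).continuousAt
  -- Near a point of this set `q` stays below `C`, so its derivative vanishes there; connectedness
  -- of the line concludes.
  have hclopen : IsClopen {t | q t = q t₀} := by
    refine ⟨isClosed_eq hcont continuous_const, isOpen_iff_mem_nhds.2 fun t ht => ?_⟩
    have ht' : q t < C := by
      rw [show q t = q t₀ from ht]
      exact h₀
    obtain ⟨δ, hδ, hball⟩ := Metric.mem_nhds_iff.1
      ((isOpen_lt hcont continuous_const).mem_nhds ht')
    filter_upwards [Metric.ball_mem_nhds t hδ] with u hu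
    have := (convex_ball t δ).is_const_of_fderivWithin_eq_zero (𝕜 := ℝ) (f := q)
      (fun v _ => (hq v).differentiableAt.differentiableWithinAt) (fun v hv => by
        rw [fderivWithin_of_isOpen Metric.isOpen_ball hv, (hq v).hasFDerivAt.fderiv,
          hq' v (hball hv)]
        ext
        simp) hu (Metric.mem_ball_self hδ)
    exact this.trans ht
  have := hclopen.eq_univ ⟨t₀, rfl⟩
  exact (this ▸ mem_univ t : t ∈ {t | q t = q t₀})

namespace Plug

variable {r : ℝ} {lam : Eucl m → (Eucl m →L[ℝ] ℝ)} (D : Plug m r lam)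

/-- An orbit that meets a tube stays at constant distance from its centre. There the angle has speed
at most `n`, while closing up forces it to grow by `b k` with `n ∣ k` and `k > 0`, hence by at least
`n`. An orbit that avoids all tubes has height speed at most `1` and height gain a positive integer.
-/
theorem one_le_period {γ : ℝ → Eucl m × ℝ} {T : ℝ}
    (hγ : IsClosedReebOrbit m r (descend (D.form 1 1)) γ T) : 1 ≤ T := by
  obtain ⟨hT, hmem, hreeb, hper⟩ := hγ
  choose v hv hderiv using hreeb
  simp only [IsReebVector, lift_form] at hv
  obtain ⟨hz, k, hk⟩ := exists_int_of_toTorus_eq (p := γ T) (p' := γ 0) (by simpa using hper 0)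
  have hn : (0 : ℝ) < D.n := by exact_mod_cast D.n_pos
  have hone : (1 : ℝ) ∈ Icc (0 : ℝ) 1 := ⟨zero_le_one, le_rfl⟩
  have hheight : height D.f (γ T) = height D.f (γ 0) + k := by
    rw [height, height, hz, hk]
    ring
  have hspin : ∀ t, HasDerivAt (fun t => spin D.τ D.f (γ t)) (dSpin D.τ lam D.f (γ t) (v t)) t :=
    fun t => (hasFDerivAt_spin D.τ (D.f_deriv _ (hmem t).1)).comp_hasDerivAt t (hderiv t)
  have hheightD : ∀ t, HasDerivAt (fun t => height D.f (γ t)) (dHeight lam (γ t) (v t)) t :=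
    fun t => (hasFDerivAt_height (D.f_deriv _ (hmem t).1)).comp_hasDerivAt t (hderiv t)
  by_cases h : ∃ t₀, ∃ q ∈ D.P, ‖spin D.τ D.f (γ t₀) - q.1‖ < q.2
  · obtain ⟨t₀, q, hq, hlt⟩ := h
    have hq2 := D.packing.pos q hq
    have hb : 0 < D.b := by linarith [D.one_le_b]
    have hlocal : ∀ t, ‖spin D.τ D.f (γ t) - q.1‖ < q.2 →
        inner ℝ (spin D.τ D.f (γ t) - q.1) (dSpin D.τ lam D.f (γ t) (v t)) = 0 ∧
        dAngle D.τ q.1 D.b lam D.f (γ t) (v t) *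
          D.tubeFactor 1 q.2 (‖spin D.τ D.f (γ t) - q.1‖ ^ 2) = 1 := fun t ht => by
      have := reeb_of_eventuallyEq_pullback D.f_smooth D.f_deriv (hmem t) hb.ne'
        (D.eventually_form_of_tube 1 (hmem t) hq ht) (D.hasDerivAt_mul_bump 1 q.2 _)
        (hv t).1 (hv t).2
      refine ⟨this.1, ?_⟩
      refine Eq.trans ?_ this.2
      congr 1
      simp only [tubeFactor, bump]
      ring
    have hsq : ∀ t, HasDerivAt (fun t => ‖spin D.τ D.f (γ t) - q.1‖ ^ 2)
        (2 * inner ℝ (spin D.τ D.f (γ t) - q.1) (dSpin D.τ lam D.f (γ t) (v t))) t :=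
      fun t => ((hspin t).sub_const q.1).norm_sq
    -- The Reeb field is tangent to the spheres only where the tube model is valid; a distance that
    -- starts below the tube radius is therefore constant for all time.
    have hconst := eq_of_hasDerivAt_zero_below (C := q.2 ^ 2) hsq (fun t ht => by
      rw [(hlocal t (lt_of_pow_lt_pow_left₀ 2 hq2.le ht)).1, mul_zero]) (t₀ := t₀) (by gcongr)
    have hin : ∀ t, ‖spin D.τ D.f (γ t) - q.1‖ < q.2 := fun t => by
      refine lt_of_pow_lt_pow_left₀ 2 hq2.le ?_
      rw [hconst t]
      gcongr
    have hangle : ∀ t, HasDerivAt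
        (fun t => D.b * height D.f (γ t) + linForm q.1 (spin D.τ D.f (γ t)))
        (dAngle D.τ q.1 D.b lam D.f (γ t) (v t)) t := fun t =>
      ((hheightD t).const_mul D.b).add ((linForm q.1).hasFDerivAt.comp_hasDerivAt t (hspin t))
    have hfac : ∀ t, 1 / (D.n : ℝ) ≤ D.tubeFactor 1 q.2 (‖spin D.τ D.f (γ t) - q.1‖ ^ 2) :=
      fun t => D.one_div_le_tubeFactor hone hq2 (sq_nonneg _)
    have hinv : (0 : ℝ) < 1 / D.n := by positivity
    have hpos : ∀ t, 0 < dAngle D.τ q.1 D.b lam D.f (γ t) (v t) := fun t =>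
      pos_of_mul_pos_left ((hlocal t (hin t)).2.symm ▸ one_pos) (hinv.trans_le (hfac t)).le
    have hle : ∀ t, dAngle D.τ q.1 D.b lam D.f (γ t) (v t) ≤ D.n := fun t => by
      have h1 := mul_le_mul_of_nonneg_left (hfac t) (hpos t).le
      rw [(hlocal t (hin t)).2, mul_one_div, div_le_one hn] at h1
      exact h1
    have hspinT : spin D.τ D.f (γ T) = rot m (((-k : ℤ) : ℝ) * D.τ) (spin D.τ D.f (γ 0)) := by
      simp only [spin]
      rw [hheight, hz, ← rot_add]
      push_cast
      ring_nf
    -- The end point in the rotating frame is the starting point turned by `-k` steps and lies in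
    -- the same ball of the packing.
    have hdvd : (D.n : ℤ) ∣ -k := by
      refine D.packing.dvd q hq (-k) (spin D.τ D.f (γ 0)) (mem_closedBall_iff_norm.2 (hin 0).le) ?_
      have := hin T
      rw [hspinT] at this
      exact mem_closedBall_iff_norm.2 this.le
    have hspinT' : spin D.τ D.f (γ T) = spin D.τ D.f (γ 0) := by
      obtain ⟨j, hj⟩ := hdvd
      have := rot_int_add_mul D.n_pos 0 j (spin D.τ D.f (γ 0))
      rw [zero_add, ← hj, Int.cast_zero, zero_mul, rot_zero] at this
      rw [hspinT]
      exact this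
    have h1 := lt_of_hasDerivAt_pos hangle hpos hT
    have h2 := sub_le_of_hasDerivAt_le hangle hle hT.le
    simp only [hspinT', hheight] at h1 h2
    have hk0 : 0 < k := by
      have : 0 < D.b * k := by linarith
      exact_mod_cast pos_of_mul_pos_right this hb.le
    have hkn : (D.n : ℝ) ≤ k := by
      exact_mod_cast Int.le_of_dvd hk0 ((dvd_neg).1 hdvd)
    have h3 : (D.n : ℝ) * 1 ≤ D.n * T := by
      have : (D.n : ℝ) ≤ D.b * k := hkn.trans (le_mul_of_one_le_left (hn.le.trans hkn) D.one_le_b)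
      linarith
    exact le_of_mul_le_mul_left h3 hn
  · push Not at h
    have hlocal : ∀ t, dHeight lam (γ t) (v t) * D.outerFactor 1 (‖(γ t).1‖ ^ 2) = 1 := fun t => by
      have := (reeb_of_eventuallyEq_pullback D.f_smooth D.f_deriv (hmem t) one_ne_zero
        (D.eventually_form_of_outside 1 (hmem t) (Or.inr (h t))) (D.hasDerivAt_mul_outer 1 _)
        (hv t).1 (hv t).2).2
      have h1 : spin 0 D.f (γ t) - 0 = (γ t).1 := by simp [spin]
      have h2 : dAngle 0 0 1 lam D.f (γ t) = dHeight lam (γ t) := by simp [dAngle, linForm]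
      rw [h1, h2] at this
      refine Eq.trans ?_ this
      congr 1
      simp only [outerFactor, outer]
      ring
    have hfac : ∀ t, 1 ≤ D.outerFactor 1 (‖(γ t).1‖ ^ 2) := fun t =>
      D.one_le_outerFactor zero_le_one (sq_nonneg _)
    have hpos : ∀ t, 0 < dHeight lam (γ t) (v t) := fun t =>
      pos_of_mul_pos_left ((hlocal t).symm ▸ one_pos) (zero_le_one.trans (hfac t))
    have hle : ∀ t, dHeight lam (γ t) (v t) ≤ 1 := fun t =>
      (le_mul_of_one_le_right (hpos t).le (hfac t)).trans_eq (hlocal t)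
    have h1 := lt_of_hasDerivAt_pos hheightD hpos hT
    have h2 := sub_le_of_hasDerivAt_le hheightD hle hT.le
    rw [hheight] at h1 h2
    have hk0 : (0 : ℝ) < k := by linarith
    have hk1 : (1 : ℝ) ≤ k := by exact_mod_cast (show 0 < k by exact_mod_cast hk0)
    linarith

end Plug

/-! ### Volume estimates -/

/-- Half-open intervals of length `1` are fundamental domains of the integer translations, and a
periodic set has the same measure in each. -/
theorem volume_inter_Ico_of_periodic {Q : Set ℝ} (hQm : MeasurableSet Q)
    (hQ : ∀ s, s + 1 ∈ Q ↔ s ∈ Q) (a : ℝ) :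
    volume ((fun s => s + a) ⁻¹' Q ∩ Ico 0 1) = volume (Q ∩ Ico 0 1) := by
  have hper : Function.Periodic (fun s => s ∈ Q) 1 := fun s => propext (hQ s)
  have hdom := (isAddFundamentalDomain_Ioc one_pos a volume).measure_set_eq
    (isAddFundamentalDomain_Ioc one_pos 0 volume) hQm fun ⟨g, k, hk⟩ => by
      ext s
      simp only at hk
      subst hk
      show k • (1 : ℝ) + s ∈ Q ↔ s ∈ Q
      rw [add_comm]
      exact iff_of_eq (hper.zsmul k s)
  have hpre : (fun s => s + a) ⁻¹' Q ∩ Ico 0 1 = (fun s => s + a) ⁻¹' (Q ∩ Ico a (a + 1)) := by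
    ext s
    simp only [mem_inter_iff, mem_preimage, mem_Ico]
    refine and_congr_right fun _ => ⟨fun h => ⟨by linarith [h.1], by linarith [h.2]⟩,
      fun h => ⟨by linarith [h.1], by linarith [h.2]⟩⟩
  rw [hpre, measure_preimage_add_right, measure_congr ((ae_eq_refl Q).inter Ico_ae_eq_Ioc), hdom,
    zero_add, measure_congr ((ae_eq_refl Q).inter (Ico_ae_eq_Ioc (a := (0 : ℝ)) (b := 1)))]

/-- Spinning preserves the volume of subsets of the mapping torus of a rotation. -/
theorem volume_preimage_spin {r τ : ℝ} {f : Eucl m → ℝ} (hf : ContDiffOn ℝ ∞ f (Metric.ball 0 r))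
    {V : Set (Eucl m)} (hV : IsOpen V) (hrot : ∀ w, rot m (-τ) w ∈ V ↔ w ∈ V) :
    volume ((coverTorus m r ∩ spin τ f ⁻¹' V) ∩ univ ×ˢ Ico (0 : ℝ) 1) =
      volume (Metric.ball 0 r ∩ V) := by
  have hmeas : ∀ {f : Eucl m → ℝ}, ContDiffOn ℝ ∞ f (Metric.ball 0 r) →
      MeasurableSet ((coverTorus m r ∩ spin τ f ⁻¹' V) ∩ univ ×ˢ Ico (0 : ℝ) 1) := fun hf =>
    ((contDiffOn_spin τ hf).continuousOn.isOpen_inter_preimage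
      (isOpen_coverTorus m r) hV).measurableSet.inter (MeasurableSet.univ.prod measurableSet_Ico)
  have h0 : ContDiffOn ℝ ∞ (fun _ : Eucl m => (0 : ℝ)) (Metric.ball 0 r) := contDiffOn_const
  have hslice : ∀ (f : Eucl m → ℝ) (z : Eucl m), z ∈ Metric.ball (0 : Eucl m) r →
      Prod.mk z ⁻¹' ((coverTorus m r ∩ spin τ f ⁻¹' V) ∩ univ ×ˢ Ico (0 : ℝ) 1) =
        (fun s => s + f z) ⁻¹' {s | rot m (-(τ * s)) z ∈ V} ∩ Ico 0 1 := fun f z hz => by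
    ext s
    simp [coverTorus, spin, height] at hz ⊢
    simp [hz]
  have hslice' : ∀ (f : Eucl m → ℝ) (z : Eucl m), z ∉ Metric.ball (0 : Eucl m) r →
      Prod.mk z ⁻¹' ((coverTorus m r ∩ spin τ f ⁻¹' V) ∩ univ ×ˢ Ico (0 : ℝ) 1) = ∅ :=
    fun f z hz => Set.eq_empty_of_forall_notMem fun s hs => hz hs.1.1.1
  have hQm : ∀ z : Eucl m, MeasurableSet {s | rot m (-(τ * s)) z ∈ V} := fun z =>
    (hV.preimage (f := fun s => rot m (-(τ * s)) z) ((contDiff_rot.continuous.comp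
      (continuous_const.mul continuous_id).neg).clm_apply continuous_const)).measurableSet
  have hQ : ∀ (z : Eucl m) (s : ℝ), s + 1 ∈ {s | rot m (-(τ * s)) z ∈ V} ↔
      s ∈ {s | rot m (-(τ * s)) z ∈ V} := fun z s => by
    rw [mem_ofPred_eq, mem_ofPred_eq, ← hrot (rot m (-(τ * s)) z), ← rot_add]
    ring_nf
  -- Over a fixed `z`, the function `f` only translates a `1`-periodic set of values of `s`, so it
  -- may be replaced by `0`.
  have hshift : volume ((coverTorus m r ∩ spin τ f ⁻¹' V) ∩ univ ×ˢ Ico (0 : ℝ) 1) =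
      volume ((coverTorus m r ∩ spin τ (fun _ => 0) ⁻¹' V) ∩ univ ×ˢ Ico (0 : ℝ) 1) := by
    rw [Measure.volume_eq_prod, Measure.prod_apply (hmeas hf), Measure.prod_apply (hmeas h0)]
    refine lintegral_congr fun z => ?_
    by_cases hz : z ∈ Metric.ball (0 : Eucl m) r
    · rw [hslice _ _ hz, hslice _ _ hz, volume_inter_Ico_of_periodic (hQm z) (hQ z),
        volume_inter_Ico_of_periodic (hQm z) (hQ z)]
    · rw [hslice' _ _ hz, hslice' _ _ hz]
  -- With `f = 0` the slice at height `s` is the preimage of `ball ∩ V` under one rotation.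
  have hfibre : ∀ s : ℝ, volume ((fun z : Eucl m => (z, s)) ⁻¹'
      ((coverTorus m r ∩ spin τ (fun _ => 0) ⁻¹' V) ∩ univ ×ˢ Ico (0 : ℝ) 1)) =
      (Ico (0 : ℝ) 1).indicator (fun _ => volume (Metric.ball 0 r ∩ V)) s := fun s => by
    by_cases hs : s ∈ Ico (0 : ℝ) 1
    · rw [indicator_of_mem hs, ← volume_preimage_rot (-(τ * s))
        (Metric.isOpen_ball.inter hV).measurableSet.nullMeasurableSet]
      congr 1
      ext z
      simp only [mem_Ico] at hs
      simp [coverTorus, spin, height, hs]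
    · rw [indicator_of_notMem hs, Set.eq_empty_of_forall_notMem (s := _ ⁻¹' _) fun z hz => hs hz.2.2,
        measure_empty]
  rw [hshift, Measure.volume_eq_prod, Measure.prod_apply_symm (hmeas h0)]
  simp only [hfibre]
  rw [lintegral_indicator measurableSet_Ico, setLIntegral_const]
  simp

namespace Plug

variable {r : ℝ} {lam : Eucl m → (Eucl m →L[ℝ] ℝ)} (D : Plug m r lam)

/-- The union of the balls in which the density is small. -/
def core : Set (Eucl m) := ⋃ q ∈ D.P, Metric.closedBall q.1 (D.θ * q.2)

theorem isClosed_core : IsClosed D.core :=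
  D.P.finite_toSet.isClosed_biUnion fun _ _ => Metric.isClosed_closedBall

theorem rot_mem_core {w : Eucl m} : rot m D.τ w ∈ D.core ↔ w ∈ D.core := by
  classical
  have h : ∀ q : Eucl m × ℝ, rot m D.τ w ∈ Metric.closedBall (rot m D.τ q.1) (D.θ * q.2) ↔
      w ∈ Metric.closedBall q.1 (D.θ * q.2) := fun q => by
    rw [Metric.mem_closedBall, dist_rot_rot, Metric.mem_closedBall]
  simp only [core, mem_iUnion₂]
  constructor
  · rintro ⟨q, hq, hw⟩
    rw [← D.image_rot, Finset.mem_image] at hq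
    obtain ⟨q', hq', rfl⟩ := hq
    exact ⟨q', hq', (h q').1 hw⟩
  · rintro ⟨q, hq, hw⟩
    exact ⟨_, D.packing.rot_mem q hq, (h q).2 hw⟩

/-- An upper bound of the density factors of the rotation. -/
def bound : ℝ := 1 + D.τ / 2 * D.r₂ ^ 2

theorem abs_contactDensity_le {p : Eucl m × ℝ} (hp : p ∈ coverTorus m r) :
    |contactDensity (D.form 1 1) p| ≤ D.bound * stdCoeff m := by
  have hC := (stdCoeff_pos m).le
  have hone : (1 : ℝ) ∈ Icc (0 : ℝ) 1 := ⟨zero_le_one, le_rfl⟩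
  by_cases h : ∀ q ∈ D.P, q.2 ≤ ‖spin D.τ D.f p - q.1‖
  · rw [D.abs_contactDensity_of_outside zero_le_one hp (Or.inr h)]
    exact mul_le_mul_of_nonneg_right (D.outerFactor_le (sq_nonneg _)) hC
  · push Not at h
    obtain ⟨q, hq, hpq⟩ := h
    rw [D.abs_contactDensity_of_tube hone hp hq hpq]
    refine mul_le_mul_of_nonneg_right ?_ hC
    exact (mul_le_of_le_one_right (by linarith [D.one_le_b])
      (D.tubeFactor_le_one zero_le_one (D.packing.pos q hq) (sq_nonneg _))).trans D.b_le

theorem abs_contactDensity_le_of_core {p : Eucl m × ℝ} (hp : p ∈ coverTorus m r)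
    (h : spin D.τ D.f p ∈ D.core) :
    |contactDensity (D.form 1 1) p| ≤ D.bound * (1 / D.n + (1 - D.θ)) * stdCoeff m := by
  obtain ⟨q, hq, hw⟩ := mem_iUnion₂.1 h
  rw [mem_closedBall_iff_norm] at hw
  have hq2 := D.packing.pos q hq
  have hθ := D.θ_pos
  have hlt : ‖spin D.τ D.f p - q.1‖ < q.2 := hw.trans_lt (mul_lt_of_lt_one_left hq2 D.θ_lt)
  rw [D.abs_contactDensity_of_tube ⟨zero_le_one, le_rfl⟩ hp hq hlt]
  refine mul_le_mul_of_nonneg_right ?_ (stdCoeff_pos m).le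
  have h1 : ‖spin D.τ D.f p - q.1‖ ^ 2 ≤ D.θ ^ 2 * q.2 ^ 2 := by
    rw [← mul_pow]
    gcongr
  have h2 : (0 : ℝ) ≤ 1 / D.n := by positivity
  exact mul_le_mul D.b_le (D.tubeFactor_le hq2 h1)
    (h2.trans (D.one_div_le_tubeFactor ⟨zero_le_one, le_rfl⟩ hq2 (sq_nonneg _)))
    (by linarith [D.one_le_b, D.b_le, show D.bound = 1 + D.τ / 2 * D.r₂ ^ 2 from rfl])

/-- The density is at most the first constant where `spin` lands in the core and at most the second
elsewhere. By the rotation invariance of the core, `volume_preimage_spin` identifies the volume of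
the second region. -/
theorem contactVolume_le : contactVolume m r (descend (D.form 1 1)) ≤
    ENNReal.ofReal (D.bound * (1 / D.n + (1 - D.θ)) * stdCoeff m) *
        volume (Metric.ball (0 : Eucl m) r) +
      ENNReal.ofReal (D.bound * stdCoeff m) * volume (Metric.ball 0 r \ D.core) := by
  set A := ENNReal.ofReal (D.bound * (1 / D.n + (1 - D.θ)) * stdCoeff m)
  set B := ENNReal.ofReal (D.bound * stdCoeff m)
  set S : Set (Eucl m × ℝ) :=
    (coverTorus m r ∩ spin D.τ D.f ⁻¹' D.coreᶜ) ∩ univ ×ˢ Ico (0 : ℝ) 1 with hS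
  have hSm : MeasurableSet S :=
    ((contDiffOn_spin D.τ D.f_smooth).continuousOn.isOpen_inter_preimage
      (isOpen_coverTorus m r) D.isClosed_core.isOpen_compl).measurableSet.inter
      (MeasurableSet.univ.prod measurableSet_Ico)
  have hdom : MeasurableSet (Metric.ball (0 : Eucl m) r ×ˢ Ico (0 : ℝ) 1) :=
    measurableSet_ball.prod measurableSet_Ico
  have hSvol : volume S = volume (Metric.ball 0 r \ D.core) :=
    volume_preimage_spin D.f_smooth D.isClosed_core.isOpen_compl fun w => by
      rw [mem_compl_iff, mem_compl_iff, ← D.rot_mem_core, rot_rot_neg]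
  rw [contactVolume, lift_form]
  calc ∫⁻ p in Metric.ball (0 : Eucl m) r ×ˢ Ico (0 : ℝ) 1,
        ENNReal.ofReal |contactDensity (D.form 1 1) p|
      ≤ ∫⁻ p in Metric.ball (0 : Eucl m) r ×ˢ Ico (0 : ℝ) 1, (A + S.indicator (fun _ => B) p) := by
        refine setLIntegral_mono' hdom fun p hp => ?_
        have hp' : p ∈ coverTorus m r := ⟨hp.1, mem_univ _⟩
        by_cases h : spin D.τ D.f p ∈ D.core
        · exact (ENNReal.ofReal_le_ofReal (D.abs_contactDensity_le_of_core hp' h)).trans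
            le_self_add
        · have hpS : p ∈ S := ⟨⟨hp', h⟩, mem_univ _, hp.2⟩
          rw [indicator_of_mem hpS]
          exact (ENNReal.ofReal_le_ofReal (D.abs_contactDensity_le hp')).trans le_add_self
    _ = A * volume (Metric.ball (0 : Eucl m) r ×ˢ Ico (0 : ℝ) 1) +
          ∫⁻ p in Metric.ball (0 : Eucl m) r ×ˢ Ico (0 : ℝ) 1, S.indicator (fun _ => B) p := by
        rw [lintegral_add_left measurable_const, setLIntegral_const]
    _ ≤ A * volume (Metric.ball (0 : Eucl m) r) + ∫⁻ p, S.indicator (fun _ => B) p := by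
        refine add_le_add (le_of_eq ?_) (setLIntegral_le_lintegral _ _)
        rw [Measure.volume_eq_prod, Measure.prod_prod]
        simp
    _ = A * volume (Metric.ball (0 : Eucl m) r) + B * volume (Metric.ball 0 r \ D.core) := by
        rw [lintegral_indicator hSm, setLIntegral_const, hSvol]

end Plug

/-! ### Choice of the parameters -/

/-- Plugs of arbitrarily small volume exist. -/
theorem exists_plug {r ε : ℝ} (hm : 1 ≤ m) (hr : 0 < r) (hε : 0 < ε)
    {lam : Eucl m → (Eucl m →L[ℝ] ℝ)} (hlam : IsPrimitive m r lam) :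
    ∃ D : Plug m r lam, contactVolume m r (descend (D.form 1 1)) < ENNReal.ofReal ε := by
  obtain ⟨f, hfs, hf⟩ := exists_potential hlam
  set C := stdCoeff m with hCdef
  have hC : 0 < C := stdCoeff_pos m
  set V := (volume (Metric.ball (0 : Eucl m) r)).toReal with hVdef
  have hV : volume (Metric.ball (0 : Eucl m) r) = ENNReal.ofReal V :=
    (ENNReal.ofReal_toReal measure_ball_lt_top.ne).symm
  have hV0 : 0 ≤ V := ENNReal.toReal_nonneg
  set η := ε / (8 * C * (V + 1)) with hηdef
  have hη : 0 < η := by positivity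
  -- The first bound makes `1/n < η`; the second makes the factor `1 + (π/n) r₂²` at most `2`.
  obtain ⟨n, hn⟩ := exists_nat_gt (max (1 / η) (Real.pi * r ^ 2))
  have hn1 : 1 / η < n := (le_max_left _ _).trans_lt hn
  have hn2 : Real.pi * r ^ 2 < n := (le_max_right _ _).trans_lt hn
  have hn0 : (0 : ℝ) < n := (by positivity : (0 : ℝ) < 1 / η).trans hn1
  have hnpos : 0 < n := by exact_mod_cast hn0
  -- The density is at most `2C`, so the uncovered part contributes less than `ε / 2`; the value of
  -- `η` gives the covered part at most `ε / 2`.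
  obtain ⟨P, hP, hPv⟩ := exists_packing hnpos hm r
    (ε := ENNReal.ofReal (ε / (4 * C))) (ENNReal.ofReal_pos.2 (by positivity)).ne'
  obtain ⟨θ, hθ0, hθ1, hθη, hθv⟩ := exists_shrink hP.pos hPv η hη
  have hclosed : IsClosed (⋃ q ∈ P, Metric.closedBall q.1 q.2) :=
    P.finite_toSet.isClosed_biUnion fun _ _ => Metric.isClosed_closedBall
  -- Finitely many closed balls in the open ball fit into a smaller one, which leaves a shell where
  -- the rotation can be switched off.
  obtain ⟨r₁, ⟨hr₁0, hr₁⟩, hr₁P⟩ := exists_pos_lt_subset_ball hr hclosed (iUnion₂_subset hP.subset)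
  have hP₁ : IsPacking n r₁ P := ⟨hP.pos, fun q hq =>
    (subset_iUnion₂_of_subset q hq subset_rfl).trans hr₁P, hP.disjoint, hP.rot_mem, hP.dvd⟩
  let D : Plug m r lam :=
    { n := n, r₁ := r₁, r₂ := (r₁ + r) / 2, θ := θ, P := P, f := f
      n_pos := hnpos
      r₁_pos := hr₁0
      r₁_lt := by linarith
      r₂_lt := by linarith
      θ_pos := hθ0
      θ_lt := hθ1
      packing := hP₁
      lam_smooth := hlam.1
      f_smooth := hfs
      f_deriv := hf }
  have hbound : D.bound ≤ 2 := by
    have h1 : ((r₁ + r) / 2) ^ 2 ≤ r ^ 2 := by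
      have : (r₁ + r) / 2 ≤ r := by linarith
      gcongr
    have h2 : Real.pi / n * r ^ 2 ≤ 1 := by
      rw [div_mul_eq_mul_div, div_le_one hn0]
      exact hn2.le
    have h3 : D.bound = 1 + Real.pi / n * ((r₁ + r) / 2) ^ 2 := by
      show 1 + 2 * Real.pi / n / 2 * ((r₁ + r) / 2) ^ 2 = _
      ring
    rw [h3]
    have h4 : Real.pi / n * ((r₁ + r) / 2) ^ 2 ≤ Real.pi / n * r ^ 2 := by gcongr
    linarith
  refine ⟨D, D.contactVolume_le.trans_lt ?_⟩
  have hnη : 1 / (n : ℝ) < η := by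
    rw [div_lt_iff₀ hn0]
    rw [div_lt_iff₀ hη] at hn1
    linarith
  have hsum : 0 ≤ 1 / (n : ℝ) + (1 - θ) := by
    have : (0 : ℝ) < 1 / n := by positivity
    linarith
  have hA : ENNReal.ofReal (D.bound * (1 / D.n + (1 - D.θ)) * C) *
      volume (Metric.ball (0 : Eucl m) r) ≤ ENNReal.ofReal (ε / 2) := by
    rw [hV, ← ENNReal.ofReal_mul' hV0]
    refine ENNReal.ofReal_le_ofReal ?_
    calc D.bound * (1 / n + (1 - θ)) * C * V ≤ 2 * (η + η) * C * V := by gcongr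
      _ ≤ 2 * (η + η) * C * (V + 1) := by gcongr; linarith
      _ = ε / 2 := by
        rw [hηdef]
        field_simp
        ring
  have hB : ENNReal.ofReal (D.bound * C) * volume (Metric.ball 0 r \ D.core) <
      ENNReal.ofReal (ε / 2) := by
    calc ENNReal.ofReal (D.bound * C) * volume (Metric.ball 0 r \ D.core)
        ≤ ENNReal.ofReal (2 * C) * volume (Metric.ball 0 r \ D.core) := by gcongr
      _ < ENNReal.ofReal (2 * C) * ENNReal.ofReal (ε / (4 * C)) :=
          (ENNReal.mul_lt_mul_iff_right (ENNReal.ofReal_pos.2 (by positivity)).ne'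
            ENNReal.ofReal_ne_top).2 hθv
      _ = ENNReal.ofReal (ε / 2) := by
          rw [← ENNReal.ofReal_mul (by positivity)]
          congr 1
          field_simp
          norm_num
  calc _ < ENNReal.ofReal (ε / 2) + ENNReal.ofReal (ε / 2) :=
        ENNReal.add_lt_add_of_le_of_lt (ne_top_of_le_ne_top ENNReal.ofReal_ne_top hA) hA hB
    _ = ENNReal.ofReal ε := by
        rw [← ENNReal.ofReal_add (by positivity) (by positivity), add_halves]

end

end ContactPlug

theorem mainTheorem7 (m : ℕ) (hm : 1 ≤ m) (r ε : ℝ) (hr : 0 < r) (hε : 0 < ε)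
    (lam : ContactPlug.Eucl m → (ContactPlug.Eucl m →L[ℝ] ℝ))
    (hlam : ContactPlug.IsPrimitive m r lam) :
    ∃ β : ContactPlug.OneForm m,
      ContactPlug.IsContactForm m r β ∧
      (∃ U ∈ 𝓝ˢ (frontier (ContactPlug.solidTorus m r)),
        EqOn β (ContactPlug.addDs lam) (U ∩ ContactPlug.solidTorus m r)) ∧
      ContactPlug.IsotopicRelBoundary m r β (ContactPlug.addDs lam) (ContactPlug.addDs lam) ∧
      (∀ (γ : ℝ → ContactPlug.Eucl m × ℝ) (T : ℝ),
        ContactPlug.IsClosedReebOrbit m r β γ T → 1 ≤ T) ∧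
      ContactPlug.contactVolume m r β < ENNReal.ofReal ε := by
  obtain ⟨D, hD⟩ := ContactPlug.exists_plug hm hr hε hlam
  exact ⟨ContactPlug.descend (D.form 1 1),
    D.isContactForm ⟨zero_le_one, le_rfl⟩ zero_le_one (Or.inr rfl),
    ⟨D.collar, D.collar_mem, D.descend_form_eqOn 1 1 _⟩, D.isotopic,
    fun _ _ hγ => D.one_le_period hγ, hD⟩
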